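/- Let $(A,\mathfrak m)$ be a Noetherian local ring with infinite residue field and let $I\subsetneq A$ be a proper ideal. Let $G(I)=\bigoplus_{n\ge0}I^n/I^{n+1}$ be the associated graded ring and $F(I)=\bigoplus_{n\ge0}I^n/\mathfrak mI^n$ the fiber cone of $I$. For a finitely generated graded module $M$ over a standard graded Noetherian ring $S$ put $a_i(M)=\max\{n : [H^i_{S_+}(M)]_n\neq0\}$ (with $a_i(M)=-\infty$ if $H^i_{S_+}(M)=0$) and $\operatorname{reg}M=\max\{a_i(M)+i : i\ge0\}$; $\operatorname{reg}F(I)$ and $\operatorname{reg}G(I)$ are the regularities of these rings as graded modules over themselves. Suppose that the analytic spread $\ell(I)=\dim F(I)$ equals $1$. Then $$\operatorname{reg}F(I)\le\operatorname{reg}G(I).$$ If moreover $\operatorname{grade}I=1$, then $$\operatorname{reg}F(I)=\operatorname{reg}G(I)=r(I),$$ where $r(I)=\min_J\min\{n\ge0 : I^{n+1}=JI^n\}$ is the reduction number of $I$, $J$ running over the minimal reductions of $I$. -/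

import Mathlib

open Polynomial

noncomputable section

namespace BlowupAlgebra

/-! ### Graded local cohomology and Castelnuovo-Mumford regularity

`S` is a commutative ring, `M` an `S`-module with homogeneous components `𝓜 n`, `n : ℕ` (a graded
ring is treated through the family of its homogeneous components). Local cohomology with respect to
`S₊` is computed by the (augmented) Čech complex of a finite system `f` of elements of degree one
that generates the ideal `S₊`. -/

section Cech

variable {S : Type*} [CommRing S] {M : Type*} [AddCommGroup M] [Module S M]

/-- The irrelevant ideal `S₊`, generated by the homogeneous elements of positive degree. -/
def irrelevantIdeal (𝒮 : ℕ → AddSubgroup S) : Ideal S :=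
  Ideal.span {x | ∃ n, 1 ≤ n ∧ x ∈ 𝒮 n}

/-- The family `f` consists of elements of degree one and generates the ideal `S₊`. -/
structure IsGeneratingSystem (𝒮 : ℕ → AddSubgroup S) {ι : Type*} (f : ι → S) : Prop where
  mem : ∀ i, f i ∈ 𝒮 1
  span_eq : Ideal.span (Set.range f) = irrelevantIdeal 𝒮

theorem isUnit_of_dvd {g h : S} (hgh : g ∣ h) (x : Submonoid.powers g) :
    IsUnit (algebraMap S (Module.End S (LocalizedModule (Submonoid.powers h) M)) x) := by
  obtain ⟨_, k, rfl⟩ := x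
  obtain ⟨c, hc⟩ := pow_dvd_pow_of_dvd hgh k
  have hu := IsLocalizedModule.map_units (LocalizedModule.mkLinearMap (Submonoid.powers h) M)
    (⟨h ^ k, k, rfl⟩ : Submonoid.powers h)
  simp only [hc, map_mul] at hu
  have hcomm : Commute
      (algebraMap S (Module.End S (LocalizedModule (Submonoid.powers h) M)) (g ^ k))
      (algebraMap S (Module.End S (LocalizedModule (Submonoid.powers h) M)) c) :=
    Algebra.commutes _ _
  exact (hcomm.isUnit_mul_iff.mp hu).1

/-- The canonical map `M_g → M_h`, `m / 1 ↦ m / 1`, for `g ∣ h`. -/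
def localizationMap (M : Type*) [AddCommGroup M] [Module S M] {g h : S} (hgh : g ∣ h) :
    LocalizedModule (Submonoid.powers g) M →ₗ[S] LocalizedModule (Submonoid.powers h) M :=
  LocalizedModule.lift (Submonoid.powers g)
    (LocalizedModule.mkLinearMap (Submonoid.powers h) M) (isUnit_of_dvd hgh)

/-- The homogeneous component of degree `n : ℤ` of `M_g`, where `g` has degree `d`: it consists of
the fractions `m / g ^ k` with `m` homogeneous of degree `n + k d`. -/
def localizationPiece (𝓜 : ℕ → AddSubgroup M) (g : S) (d : ℕ) (n : ℤ) :
    AddSubgroup (LocalizedModule (Submonoid.powers g) M) :=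
  AddSubgroup.closure {y | ∃ (k e : ℕ) (m : M), m ∈ 𝓜 e ∧ (e : ℤ) = n + k * d ∧
    y = LocalizedModule.mk m (⟨g ^ k, k, rfl⟩ : Submonoid.powers g)}

variable {ι : Type*} (f : ι → S)

/-- Čech cochains: `C^p = ∏ M_{f_{i_1} ⋯ f_{i_p}}`, over all `p`-tuples of indices; for `p = 0` this
is `M` (localized at `1`). -/
abbrev CechCochain (M : Type*) [AddCommGroup M] [Module S M] (p : ℕ) : Type _ :=
  ∀ σ : Fin p → ι, LocalizedModule (Submonoid.powers (∏ j, f (σ j))) M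

theorem prod_succAbove_dvd {p : ℕ} (σ : Fin (p + 1) → ι) (j : Fin (p + 1)) :
    (∏ l, f (σ (j.succAbove l))) ∣ ∏ l, f (σ l) :=
  ⟨f (σ j), by rw [Fin.prod_univ_succAbove _ j, mul_comm]⟩

/-- The Čech differential, the alternating sum of the maps that omit one index. -/
def cechDiff (M : Type*) [AddCommGroup M] [Module S M] (p : ℕ) :
    CechCochain f M p →ₗ[S] CechCochain f M (p + 1) :=
  LinearMap.pi fun σ => ∑ j : Fin (p + 1), (-1 : S) ^ (j : ℕ) •
    (localizationMap M (prod_succAbove_dvd f σ j)).comp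
      (LinearMap.proj (fun l => σ (j.succAbove l)))

/-- The homogeneous cochains of degree `n` (the elements `f i` have degree one). -/
def cechPiece (𝓜 : ℕ → AddSubgroup M) (p : ℕ) (n : ℤ) : AddSubgroup (CechCochain f M p) :=
  AddSubgroup.pi Set.univ fun σ => localizationPiece 𝓜 (∏ j, f (σ j)) p n

/-- The cocycles of degree `n` in `C^p`. -/
def cechCocycles (𝓜 : ℕ → AddSubgroup M) (p : ℕ) (n : ℤ) : AddSubgroup (CechCochain f M p) :=
  (cechDiff f M p).toAddMonoidHom.ker ⊓ cechPiece f 𝓜 p n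

/-- The coboundaries of degree `n` in `C^p`. -/
def cechCoboundaries (𝓜 : ℕ → AddSubgroup M) (p : ℕ) (n : ℤ) :
    AddSubgroup (CechCochain f M p) :=
  match p with
  | 0 => ⊥
  | p + 1 => (cechPiece f 𝓜 p n).map (cechDiff f M p).toAddMonoidHom

/-- The homogeneous component `[H^i_{S₊}(M)]_n` of local cohomology. -/
abbrev LocalCohomologyPiece (𝓜 : ℕ → AddSubgroup M) (i : ℕ) (n : ℤ) : Type _ :=
  cechCocycles f 𝓜 i n ⧸ (cechCoboundaries f 𝓜 i n).addSubgroupOf (cechCocycles f 𝓜 i n)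

/-- `a_i(M)`, the largest degree in which `H^i_{S₊}(M)` does not vanish, and `-∞` if there is
none. -/
def aInvariant (𝓜 : ℕ → AddSubgroup M) (i : ℕ) : EReal :=
  ⨆ (n : ℤ) (_ : Nontrivial (LocalCohomologyPiece f 𝓜 i n)), ((n : ℝ) : EReal)

/-- The Castelnuovo-Mumford regularity `reg M = max {a_i(M) + i | i ≥ 0}`. -/
def regularity (𝓜 : ℕ → AddSubgroup M) : EReal :=
  ⨆ i : ℕ, aInvariant f 𝓜 i + ((i : ℝ) : EReal)

end Cech

/-! ### Associated graded ring and fiber cone -/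

section Blowup

variable {A : Type*} [CommRing A]

/-- The homogeneous component `I ^ n t ^ n` of the Rees algebra of `I`. -/
def reesPiece (I : Ideal A) (n : ℕ) : AddSubgroup (reesAlgebra I) where
  carrier := {x | ∃ a ∈ I ^ n, (x : A[X]) = monomial n a}
  zero_mem' := ⟨0, zero_mem _, by simp⟩
  add_mem' := by
    rintro x y ⟨a, ha, hx⟩ ⟨b, hb, hy⟩
    exact ⟨a + b, add_mem ha hb, by simp [hx, hy]⟩
  neg_mem' := by
    rintro x ⟨a, ha, hx⟩
    exact ⟨-a, neg_mem ha, by simp [hx]⟩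

/-- `R(I) / J R(I) = ⨁ I ^ n / J I ^ n`. -/
abbrev ReesQuotient (I J : Ideal A) : Type _ :=
  reesAlgebra I ⧸ J.map (algebraMap A (reesAlgebra I))

/-- The homogeneous component of degree `n` of `R(I) / J R(I)`. -/
def reesQuotientPiece (I J : Ideal A) (n : ℕ) : AddSubgroup (ReesQuotient I J) :=
  (reesPiece I n).map (Ideal.Quotient.mk (J.map (algebraMap A (reesAlgebra I)))).toAddMonoidHom

/-- Generators of `I` give a finite generating system of `R(I) / J R(I)`. -/
theorem exists_isGeneratingSystem [IsNoetherianRing A] (I J : Ideal A) :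
    ∃ (s : ℕ) (f : Fin s → ReesQuotient I J), IsGeneratingSystem (reesQuotientPiece I J) f := by
  obtain ⟨s, a, ha⟩ := Submodule.fg_iff_exists_fin_generating_family.mp (IsNoetherian.noetherian I)
  have haI : ∀ i, a i ∈ I := fun i => ha ▸ Submodule.subset_span ⟨i, rfl⟩
  let F : I → reesAlgebra I := fun b =>
    ⟨monomial 1 (b : A), reesAlgebra.monomial_mem.mpr (by simp)⟩
  let q := Ideal.Quotient.mk (J.map (algebraMap A (reesAlgebra I)))
  have hmem : ∀ b : I, q (F b) ∈ reesQuotientPiece I J 1 := fun b =>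
    ⟨F b, ⟨b, by simp, rfl⟩, rfl⟩
  refine ⟨s, fun i => q (F ⟨a i, haI i⟩), fun i => hmem _, le_antisymm ?_ ?_⟩
  · rw [Ideal.span_le]
    rintro _ ⟨i, rfl⟩
    exact Ideal.subset_span ⟨1, le_rfl, hmem _⟩
  · rw [irrelevantIdeal, Ideal.span_le]
    rintro _ ⟨n, hn, x, ⟨b, hb, hx⟩, rfl⟩
    obtain ⟨n, rfl⟩ : ∃ m, n = m + 1 := ⟨n - 1, by omega⟩
    change q x ∈ Ideal.span (Set.range fun i => q (F ⟨a i, haI i⟩))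
    have key : ∀ c (hc : c ∈ I), q (F ⟨c, hc⟩) ∈
        Ideal.span (Set.range fun i => q (F ⟨a i, haI i⟩)) := by
      intro c hc
      obtain ⟨w, rfl⟩ := (Submodule.mem_span_range_iff_exists_fun A).mp (ha ▸ hc)
      have : F ⟨_, hc⟩ = ∑ i, algebraMap A (reesAlgebra I) (w i) * F ⟨a i, haI i⟩ := by
        apply Subtype.ext
        simp [F, C_mul_monomial, map_sum]
      rw [this, map_sum]
      refine Ideal.sum_mem _ fun i _ => ?_
      rw [map_mul]
      exact Ideal.mul_mem_left _ _ (Ideal.subset_span ⟨i, rfl⟩)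
    have key2 : ∀ b ∈ I ^ (n + 1), ∀ x : reesAlgebra I, (x : A[X]) = monomial (n + 1) b →
        q x ∈ Ideal.span (Set.range fun i => q (F ⟨a i, haI i⟩)) := by
      intro b hb
      rw [pow_succ] at hb
      induction hb using Submodule.mul_induction_on' with
      | mem_mul_mem u hu v hv =>
        intro x hx
        have : x = ⟨monomial n u, reesAlgebra.monomial_mem.mpr hu⟩ * F ⟨v, hv⟩ := by
          apply Subtype.ext
          simp [F, hx, monomial_mul_monomial]
        rw [this, map_mul]
        exact Ideal.mul_mem_left _ _ (key v hv)
      | add u hu v hv h1 h2 =>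
        intro x hx
        rw [← pow_succ] at hu hv
        have : x = ⟨monomial (n+1) u, reesAlgebra.monomial_mem.mpr hu⟩ +
          ⟨monomial (n+1) v, reesAlgebra.monomial_mem.mpr hv⟩ := by
          apply Subtype.ext
          simp [hx]
        rw [this, map_add]
        exact add_mem (h1 _ rfl) (h2 _ rfl)
    exact key2 b hb x hx

/-- The associated graded ring `G(I) = R(I) / I R(I) = ⨁ I ^ n / I ^ (n + 1)`. -/
abbrev AssociatedGradedRing (I : Ideal A) : Type _ := ReesQuotient I I

/-- The grading of `G(I)`. -/
abbrev assocGrading (I : Ideal A) : ℕ → AddSubgroup (AssociatedGradedRing I) :=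
  reesQuotientPiece I I

/-- The fiber cone `F(I) = R(I) / 𝔪 R(I) = ⨁ I ^ n / 𝔪 I ^ n`. -/
abbrev FiberCone [IsLocalRing A] (I : Ideal A) : Type _ :=
  ReesQuotient I (IsLocalRing.maximalIdeal A)

/-- The grading of `F(I)`. -/
abbrev fiberGrading [IsLocalRing A] (I : Ideal A) : ℕ → AddSubgroup (FiberCone I) :=
  reesQuotientPiece I (IsLocalRing.maximalIdeal A)

/-- The analytic spread `ℓ(I) = dim F(I)`. -/
def analyticSpread [IsLocalRing A] (I : Ideal A) : WithBot ℕ∞ := ringKrullDim (FiberCone I)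

/-- The grade of `I`: the supremum of the lengths of the `A`-regular sequences in `I`. -/
def idealGrade (I : Ideal A) : ℕ∞ :=
  ⨆ (rs : List A) (_ : RingTheory.Sequence.IsRegular A rs ∧ ∀ r ∈ rs, r ∈ I), (rs.length : ℕ∞)

/-- `J` is a reduction of `I`. -/
def IsReduction (J I : Ideal A) : Prop := J ≤ I ∧ ∃ n : ℕ, I ^ (n + 1) = J * I ^ n

/-- `J` is a minimal reduction of `I`: minimal under inclusion among the reductions of `I`. -/
def IsMinimalReduction (J I : Ideal A) : Prop := Minimal (fun K => IsReduction K I) J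

/-- `r_J(I)`, the least `n` with `I ^ (n + 1) = J I ^ n`. -/
def reductionNumberWith (J I : Ideal A) : ℕ := sInf {n : ℕ | I ^ (n + 1) = J * I ^ n}

/-- The reduction number `r(I)`: the least `r_J(I)` for `J` a minimal reduction of `I`. -/
def reductionNumber (I : Ideal A) : ℕ :=
  sInf {n : ℕ | ∃ J, IsMinimalReduction J I ∧ n = reductionNumberWith J I}

end Blowup

end BlowupAlgebra

end

/-! Since F(I) has dimension one and the residue field is infinite, prime avoidance in F(I) produces
an element x of I whose degree-one class generates the irrelevant ideal up to radical. By Nakayama,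
(x) is a reduction of I. Let r be its reduction number. Both F(I) and G(I) are then graded rings S
with an element x of degree one such that S_{n+1} = x S_n for n ≥ r.

For such S the Čech complex is transparent. Each f_i has a power divisible by x, so x acts
bijectively on cochains of positive cohomological degree, while every class in H^p, p ≥ 1, is killed
by a power of x. Hence H^p = 0 for p ≥ 2, H^1 vanishes in degrees ≥ r, and H^0 is the x-torsion. So
reg S is at most the maximum of r and the torsion degrees (`regularity_le_of_torsion`). Conversely,
r ≤ reg S when r is minimal: if u in S_r is not in x S_{r-1}, then either u/x is a nonzero class in
H^1 of degree r - 1, or u - xv is nonzero torsion of degree r for some v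
(`le_regularity_of_minimal`).

To compare the two rings, let a in I^n, n ≥ r, represent nonzero x-torsion in F(I). Then x^k a lies
in 𝔪 I^(n+k) = x^k 𝔪 I^n, so x^k (a - b) = 0 in A for some b in 𝔪 I^n. Here a - b ≠ 0, and its
initial form in G(I) is x-torsion of degree at least n (`IsReesQuotient.regularity_le_regularity`).

If grade I = 1, then x is regular, so G(I) has no x-torsion in degrees ≥ r and r ≤ reg F(I) ≤ reg
G(I) ≤ r. Thus r is the same for all principal reductions, and the minimal reductions are exactly
these. -/

open Polynomial

noncomputable section

namespace BlowupAlgebra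

/-! ### Homogeneous fractions in localizations at one element -/

section Fractions

variable {S : Type*} [CommRing S]

/-- The fraction `m / g ^ k`. -/
def frac (g : S) (k : ℕ) (m : S) : LocalizedModule (Submonoid.powers g) S :=
  LocalizedModule.mk m (⟨g ^ k, k, rfl⟩ : Submonoid.powers g)

theorem exists_eq_frac {g : S} (y : LocalizedModule (Submonoid.powers g) S) :
    ∃ k m, y = frac g k m := by
  induction y using LocalizedModule.induction_on with
  | h m s =>
    obtain ⟨_, k, rfl⟩ := s
    exact ⟨k, m, rfl⟩

theorem frac_eq_zero_iff {g : S} {k : ℕ} {m : S} : frac g k m = 0 ↔ ∃ j, g ^ j * m = 0 := by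
  rw [frac, ← LocalizedModule.zero_mk (1 : Submonoid.powers g), LocalizedModule.mk_eq]
  constructor
  · rintro ⟨⟨_, j, rfl⟩, h⟩
    exact ⟨j, by simpa [Submonoid.smul_def] using h⟩
  · rintro ⟨j, h⟩
    exact ⟨⟨g ^ j, j, rfl⟩, by simpa [Submonoid.smul_def] using h⟩

theorem smul_frac (a g : S) (k : ℕ) (m : S) : a • frac g k m = frac g k (a * m) := by
  rw [frac, LocalizedModule.smul'_mk, smul_eq_mul, frac]

theorem frac_pow_mul (g : S) (k j : ℕ) (m : S) : frac g (k + j) (g ^ j * m) = frac g k m := by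
  rw [frac, frac, LocalizedModule.mk_eq]
  refine ⟨1, ?_⟩
  simp only [one_smul, Submonoid.smul_def, smul_eq_mul]
  ring

theorem frac_add (g : S) (k : ℕ) (m m' : S) :
    frac g k (m + m') = frac g k m + frac g k m' := by
  rw [frac, frac, frac, LocalizedModule.mk_add_mk, LocalizedModule.mk_eq]
  refine ⟨1, ?_⟩
  simp only [one_smul, Submonoid.smul_def, smul_eq_mul, Submonoid.coe_mul]
  change g ^ k * g ^ k * (m + m') = g ^ k * (g ^ k * m + g ^ k * m')
  ring

theorem frac_neg (g : S) (k : ℕ) (m : S) : frac g k (-m) = -frac g k m := by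
  rw [← neg_one_mul, ← smul_frac, neg_one_smul]

theorem frac_sub (g : S) (k : ℕ) (m m' : S) :
    frac g k (m - m') = frac g k m - frac g k m' := by
  rw [sub_eq_add_neg, frac_add, frac_neg, ← sub_eq_add_neg]

theorem frac_zero (g : S) (k : ℕ) : frac g k 0 = 0 := LocalizedModule.zero_mk _

theorem pow_smul_frac (g : S) (k : ℕ) (m : S) : g ^ k • frac g k m = frac g 0 m := by
  rw [smul_frac]
  simpa using frac_pow_mul g 0 k m

theorem pow_smul_injective (g : S) (k : ℕ) {y : LocalizedModule (Submonoid.powers g) S}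
    (h : g ^ k • y = 0) : y = 0 := by
  obtain ⟨l, m, rfl⟩ := exists_eq_frac y
  rw [smul_frac, frac_eq_zero_iff] at h
  obtain ⟨j, h⟩ := h
  exact frac_eq_zero_iff.mpr ⟨j + k, by rw [pow_add, mul_assoc, h]⟩

theorem localizationMap_frac_zero {g h : S} (hgh : g ∣ h) (m : S) :
    localizationMap S hgh (frac g 0 m) = frac h 0 m := by
  have h1 : ∀ g : S, frac g 0 m = LocalizedModule.mk m 1 := fun g => by
    rw [frac]; congr 1; ext; simp
  rw [h1, h1, localizationMap, LocalizedModule.lift_mk_one]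
  rfl

theorem localizationMap_frac {g h c : S} (hgh : g ∣ h) (hc : h = g * c) (k : ℕ) (m : S) :
    localizationMap S hgh (frac g k m) = frac h k (c ^ k * m) := by
  rw [← sub_eq_zero]
  apply pow_smul_injective h k
  have hk : h ^ k = c ^ k * g ^ k := by rw [hc]; ring
  rw [smul_sub, pow_smul_frac, hk, mul_smul, ← map_smul, pow_smul_frac,
    localizationMap_frac_zero, smul_frac, sub_self]

theorem localizationMap_localizationMap {g h h' : S} (hgh : g ∣ h) (hh : h ∣ h')
    (y : LocalizedModule (Submonoid.powers g) S) :
    localizationMap S hh (localizationMap S hgh y) = localizationMap S (hgh.trans hh) y := by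
  obtain ⟨k, m, rfl⟩ := exists_eq_frac y
  obtain ⟨c, hc⟩ := id hgh
  obtain ⟨c', hc'⟩ := id hh
  rw [localizationMap_frac _ hc, localizationMap_frac _ hc',
    localizationMap_frac (c := c * c') _ (by rw [hc', hc, mul_assoc])]
  congr 1
  ring

/-- An element of the kernel of `S_g → S_{gc}` is killed by a power of `c`. -/
theorem exists_pow_smul_eq_zero {g h c : S} (hgh : g ∣ h) (hc : h = g * c)
    {z : LocalizedModule (Submonoid.powers g) S} (hz : localizationMap S hgh z = 0) :
    ∃ k, c ^ k • z = 0 := by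
  obtain ⟨k, m, rfl⟩ := exists_eq_frac z
  rw [localizationMap_frac _ hc, frac_eq_zero_iff] at hz
  obtain ⟨j, hj⟩ := hz
  refine ⟨j + k, ?_⟩
  rw [smul_frac, frac_eq_zero_iff]
  refine ⟨j, ?_⟩
  rw [← hj, hc]
  ring

variable {𝒮 : ℕ → AddSubgroup S}

theorem frac_mem_localizationPiece {g : S} {d k e : ℕ} {n : ℤ} {m : S} (hm : m ∈ 𝒮 e)
    (he : (e : ℤ) = n + k * d) : frac g k m ∈ localizationPiece 𝒮 g d n :=
  AddSubgroup.subset_closure ⟨k, e, m, hm, he, rfl⟩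

variable [SetLike.GradedMonoid 𝒮]

theorem pow_mem_of_mem {a : S} {d : ℕ} (ha : a ∈ 𝒮 d) (k : ℕ) : a ^ k ∈ 𝒮 (k * d) := by
  simpa using SetLike.pow_mem_graded k ha

theorem mul_mem_of_mem {a b : S} {d e n : ℕ} (ha : a ∈ 𝒮 d) (hb : b ∈ 𝒮 e) (hn : d + e = n) :
    a * b ∈ 𝒮 n := hn ▸ SetLike.mul_mem_graded ha hb

/-- A common denominator makes the generating fractions closed under addition. The alternative y = 0
matters only for d = 0 and n < 0, where no fraction has the required degree. -/
theorem eq_zero_or_eq_frac_of_mem {g : S} {d : ℕ} (hg : g ∈ 𝒮 d) {n : ℤ}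
    {y : LocalizedModule (Submonoid.powers g) S} (hy : y ∈ localizationPiece 𝒮 g d n) :
    y = 0 ∨ ∃ (k e : ℕ) (m : S), m ∈ 𝒮 e ∧ (e : ℤ) = n + k * d ∧ y = frac g k m := by
  induction hy using AddSubgroup.closure_induction with
  | mem y hy => exact .inr hy
  | zero => exact .inl rfl
  | add y z _ _ hy hz =>
    obtain rfl | ⟨k, e, m, hm, he, rfl⟩ := hy
    · rwa [zero_add]
    obtain rfl | ⟨k', e', m', hm', he', rfl⟩ := hz
    · rw [add_zero]; exact .inr ⟨k, e, m, hm, he, rfl⟩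
    refine .inr ⟨k + k', k' * d + e, g ^ k' * m + g ^ k * m', add_mem ?_ ?_, ?_, ?_⟩
    · exact mul_mem_of_mem (pow_mem_of_mem hg k') hm rfl
    · refine mul_mem_of_mem (pow_mem_of_mem hg k) hm' ?_
      zify
      rw [he, he']
      ring
    · push_cast
      rw [he]
      ring
    · rw [frac_add, frac_pow_mul, add_comm k, frac_pow_mul]
  | neg y _ hy =>
    obtain rfl | ⟨k, e, m, hm, he, rfl⟩ := hy
    · exact .inl neg_zero
    · exact .inr ⟨k, e, -m, neg_mem hm, he, (frac_neg _ _ _).symm⟩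

theorem smul_mem_localizationPiece {g a : S} {d b : ℕ} (hg : g ∈ 𝒮 d) (ha : a ∈ 𝒮 b) {n : ℤ}
    {y : LocalizedModule (Submonoid.powers g) S} (hy : y ∈ localizationPiece 𝒮 g d n) :
    a • y ∈ localizationPiece 𝒮 g d (n + b) := by
  obtain rfl | ⟨k, e, m, hm, he, rfl⟩ := eq_zero_or_eq_frac_of_mem hg hy
  · rw [smul_zero]; exact zero_mem _
  · rw [smul_frac]
    refine frac_mem_localizationPiece (mul_mem_of_mem ha hm rfl) ?_
    push_cast
    rw [he]
    ring

/-- A homogeneous fraction in `S_{gc}` comes from `S_g` after multiplication by a power of `c`. -/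
theorem exists_localizationMap_eq_pow_smul {g h c : S} {d : ℕ} (hg : h ∈ 𝒮 (d + 1))
    (hc1 : c ∈ 𝒮 1) (hgh : g ∣ h) (hc : h = g * c) {n : ℤ}
    {y : LocalizedModule (Submonoid.powers h) S} (hy : y ∈ localizationPiece 𝒮 h (d + 1) n) :
    ∃ k₀ : ℕ, ∀ k ≥ k₀, ∃ z ∈ localizationPiece 𝒮 g d (n + k),
      localizationMap S hgh z = c ^ k • y := by
  obtain rfl | ⟨k₀, e, m, hm, he, rfl⟩ := eq_zero_or_eq_frac_of_mem hg hy
  · exact ⟨0, fun k _ => ⟨0, zero_mem _, by simp⟩⟩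
  · refine ⟨k₀, fun k hk => ?_⟩
    obtain ⟨j, rfl⟩ := Nat.exists_eq_add_of_le hk
    refine ⟨frac g k₀ (c ^ j * m), frac_mem_localizationPiece
      (mul_mem_of_mem (pow_mem_of_mem hc1 j) hm rfl) ?_, ?_⟩
    · push_cast
      rw [he]
      push_cast
      ring
    · rw [localizationMap_frac _ hc, smul_frac]
      congr 1
      ring

/-- An element `x` dividing a power of `g` acts surjectively on `S_g`. -/
theorem exists_smul_eq_of_mul_eq_pow {g x w : S} {d b N : ℕ} (hg : g ∈ 𝒮 d) (hw : w ∈ 𝒮 b)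
    (hb : b + 1 = N * d) (hxw : x * w = g ^ N) {n : ℤ}
    {y : LocalizedModule (Submonoid.powers g) S} (hy : y ∈ localizationPiece 𝒮 g d n) :
    ∃ z ∈ localizationPiece 𝒮 g d (n - 1), x • z = y := by
  obtain rfl | ⟨k, e, m, hm, he, rfl⟩ := eq_zero_or_eq_frac_of_mem hg hy
  · exact ⟨0, zero_mem _, smul_zero _⟩
  · refine ⟨frac g (k + N) (w * m), frac_mem_localizationPiece (mul_mem_of_mem hw hm rfl) ?_, ?_⟩
    · have hb : (b : ℤ) + 1 = N * d := by exact_mod_cast hb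
      push_cast
      linear_combination he + hb
    · rw [smul_frac, ← mul_assoc, hxw, frac_pow_mul]

theorem smul_injective_of_mul_eq_pow {g x w : S} {N : ℕ} (hxw : x * w = g ^ N)
    {y : LocalizedModule (Submonoid.powers g) S} (hy : x • y = 0) : y = 0 := by
  apply pow_smul_injective g N
  rw [← hxw, mul_comm, mul_smul, hy, smul_zero]

end Fractions

/-! ### Multiplication by f i and by x on the Čech complex -/

section Cochains

variable {S : Type*} [CommRing S] {𝒮 : ℕ → AddSubgroup S} {ι : Type*} {f : ι → S}

theorem cechDiff_apply (p : ℕ) (c : CechCochain f S p) (σ : Fin (p + 1) → ι) :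
    cechDiff f S p c σ = ∑ j : Fin (p + 1), (-1 : S) ^ (j : ℕ) •
      localizationMap S (prod_succAbove_dvd f σ j) (c fun l => σ (j.succAbove l)) := by
  simp [cechDiff]

theorem mem_cechPiece_iff {p : ℕ} {n : ℤ} {c : CechCochain f S p} :
    c ∈ cechPiece f 𝒮 p n ↔ ∀ σ : Fin p → ι, c σ ∈ localizationPiece 𝒮 (∏ j, f (σ j)) p n :=
  ⟨fun h σ => h σ (Set.mem_univ σ), fun h σ _ => h σ⟩

theorem mem_cechCocycles_iff {p : ℕ} {n : ℤ} {c : CechCochain f S p} :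
    c ∈ cechCocycles f 𝒮 p n ↔ cechDiff f S p c = 0 ∧ c ∈ cechPiece f 𝒮 p n :=
  Iff.rfl

theorem mem_cechCoboundaries_succ_iff {p : ℕ} {n : ℤ} {c : CechCochain f S (p + 1)} :
    c ∈ cechCoboundaries f 𝒮 (p + 1) n ↔ ∃ u ∈ cechPiece f 𝒮 p n, cechDiff f S p u = c :=
  Iff.rfl

theorem nontrivial_localCohomologyPiece_iff {p : ℕ} {n : ℤ} :
    Nontrivial (LocalCohomologyPiece f 𝒮 p n) ↔
      ¬ cechCocycles f 𝒮 p n ≤ cechCoboundaries f 𝒮 p n := by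
  rw [← not_subsingleton_iff_nontrivial, QuotientAddGroup.subsingleton_iff,
    AddSubgroup.addSubgroupOf_eq_top]

theorem localizationMap_congr {p : ℕ} (c : CechCochain f S p) {σ τ : Fin p → ι} (h : σ = τ)
    {g : S} (hσ : ∏ j, f (σ j) ∣ g) (hτ : ∏ j, f (τ j) ∣ g) :
    localizationMap S hσ (c σ) = localizationMap S hτ (c τ) := by
  subst h; rfl

variable [SetLike.GradedMonoid 𝒮]

theorem prod_mem_graded (hf : ∀ i, f i ∈ 𝒮 1) {p : ℕ} (σ : Fin p → ι) :
    ∏ j, f (σ j) ∈ 𝒮 p := by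
  induction p with
  | zero => simpa using SetLike.one_mem_graded 𝒮
  | succ p ih =>
    rw [Fin.prod_univ_succ]
    exact mul_mem_of_mem (hf _) (ih fun j => σ j.succ) (add_comm _ _)

theorem smul_mem_cechPiece (hf : ∀ i, f i ∈ 𝒮 1) {p b : ℕ} {n : ℤ} {a : S} (ha : a ∈ 𝒮 b)
    {c : CechCochain f S p} (hc : c ∈ cechPiece f 𝒮 p n) : a • c ∈ cechPiece f 𝒮 p (n + b) :=
  mem_cechPiece_iff.mpr fun σ =>
    smul_mem_localizationPiece (prod_mem_graded hf σ) ha (mem_cechPiece_iff.mp hc σ)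

/-- A power of `f i` kills the class of a Čech cocycle: the cone construction with vertex `i`. -/
theorem exists_cechDiff_eq_pow_smul [Finite ι] (hf : ∀ i, f i ∈ 𝒮 1) (i : ι) {p : ℕ} {n : ℤ}
    {c : CechCochain f S (p + 1)} (hc : c ∈ cechCocycles f 𝒮 (p + 1) n) :
    ∃ k : ℕ, ∃ u ∈ cechPiece f 𝒮 p (n + k), cechDiff f S p u = f i ^ k • c := by
  obtain ⟨hdc, hcp⟩ := mem_cechCocycles_iff.mp hc
  rw [mem_cechPiece_iff] at hcp
  have hprod : ∀ {q : ℕ} (τ : Fin q → ι),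
      ∏ j, f ((Fin.cons i τ : Fin (q + 1) → ι) j) = (∏ j, f (τ j)) * f i := fun τ => by
    rw [Fin.prod_univ_succ, mul_comm]; simp
  have hdvd : ∀ {q : ℕ} (τ : Fin q → ι),
      ∏ j, f (τ j) ∣ ∏ j, f ((Fin.cons i τ : Fin (q + 1) → ι) j) := fun τ => ⟨f i, hprod τ⟩
  -- There are finitely many tuples, so one exponent serves them all.
  have hfin : ∀ {q : ℕ} {P : (Fin q → ι) → ℕ → Prop},
      (∀ τ, ∃ k₀, ∀ k ≥ k₀, P τ k) → ∃ k, ∀ τ, P τ k := by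
    intro q P h
    choose k₀ hk₀ using h
    obtain ⟨k, hk⟩ := (Set.finite_range k₀).bddAbove
    exact ⟨k, fun τ => hk₀ τ k (hk ⟨τ, rfl⟩)⟩
  -- The cone: e τ is a lift of f i ^ k₁ • c (i, τ) to the localization without the factor f i.
  obtain ⟨k₁, hk₁⟩ := hfin fun τ : Fin p → ι =>
    exists_localizationMap_eq_pow_smul (prod_mem_graded hf (Fin.cons i τ)) (hf i)
      (hdvd τ) (hprod τ) (hcp (Fin.cons i τ))
  choose e he hemap using hk₁
  -- The cocycle condition at (i, τ) writes c τ as the alternating sum of the c (i, τ without τ j).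
  -- Hence d e and f i ^ k₁ • c agree after inverting f i, and a further power of f i removes the
  -- difference.
  have hzero : ∀ τ : Fin (p + 1) → ι,
      localizationMap S (hdvd τ) ((cechDiff f S p e - f i ^ k₁ • c) τ) = 0 := by
    intro τ
    have h := congrFun hdc (Fin.cons i τ)
    rw [cechDiff_apply, Fin.sum_univ_succ] at h
    have h0 : (fun l => (Fin.cons i τ : Fin (p + 2) → ι) ((0 : Fin (p + 2)).succAbove l)) = τ := by
      funext l; simp
    have hs : ∀ j : Fin (p + 1),
        (fun l => (Fin.cons i τ : Fin (p + 2) → ι) (j.succ.succAbove l)) =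
          Fin.cons i (fun l => τ (j.succAbove l)) := by
      intro j
      funext l
      refine Fin.cases ?_ (fun l => ?_) l <;> simp
    rw [localizationMap_congr c h0 _ (hdvd τ)] at h
    have hdvd' : ∀ j : Fin (p + 1),
        ∏ l, f ((Fin.cons i (fun l => τ (j.succAbove l)) : Fin (p + 1) → ι) l) ∣
          ∏ l, f ((Fin.cons i τ : Fin (p + 2) → ι) l) := fun j => by
      rw [hprod, hprod]
      exact mul_dvd_mul_right (prod_succAbove_dvd f τ j) _
    simp_rw [fun j => localizationMap_congr c (hs j) (prod_succAbove_dvd f _ j.succ) (hdvd' j)] at h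
    simp only [Fin.val_zero, pow_zero, one_smul, Fin.val_succ, pow_succ, mul_neg, mul_one, neg_smul,
      Finset.sum_neg_distrib, Pi.zero_apply] at h
    rw [← sub_eq_add_neg, sub_eq_zero] at h
    rw [Pi.sub_apply, map_sub, Pi.smul_apply, map_smul, h, cechDiff_apply, map_sum,
      Finset.smul_sum, sub_eq_zero]
    refine Finset.sum_congr rfl fun j _ => ?_
    rw [map_smul, smul_comm (f i ^ k₁),
      ← LinearMap.map_smul (localizationMap S (hdvd' j)) (f i ^ k₁), ← hemap,
      localizationMap_localizationMap, localizationMap_localizationMap]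
  obtain ⟨k₂, hk₂⟩ := hfin (P := fun τ k => f i ^ k • (cechDiff f S p e - f i ^ k₁ • c) τ = 0)
    fun τ => by
      obtain ⟨k₀, hk₀⟩ := exists_pow_smul_eq_zero (hdvd τ) (hprod τ) (hzero τ)
      refine ⟨k₀, fun k hk => ?_⟩
      rw [← Nat.sub_add_cancel hk, pow_add, mul_smul, hk₀, smul_zero]
  refine ⟨k₁ + k₂, f i ^ k₂ • e, ?_, ?_⟩
  · have := smul_mem_cechPiece hf (pow_mem_of_mem (hf i) k₂) (mem_cechPiece_iff.mpr he)
    simpa [add_assoc] using this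
  · rw [map_smul, ← sub_eq_zero]
    funext τ
    rw [add_comm k₁ k₂, pow_add, mul_smul, ← smul_sub]
    exact hk₂ τ

/-- A tuple of length p + 1 has a first entry, and x already divides the (b + 1)-st power of that
factor. -/
theorem exists_mul_eq_prod_pow {x : S} {b : ℕ} (hf : ∀ i, f i ∈ 𝒮 1)
    (hx : ∀ u ∈ 𝒮 (b + 1), ∃ v ∈ 𝒮 b, u = x * v) {p : ℕ} (σ : Fin (p + 1) → ι) :
    ∃ w ∈ 𝒮 ((b + 1) * (p + 1) - 1), x * w = (∏ j, f (σ j)) ^ (b + 1) := by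
  obtain ⟨v, hv, hxv⟩ := hx (f (σ 0) ^ (b + 1)) (by simpa using pow_mem_of_mem (hf (σ 0)) (b + 1))
  refine ⟨v * (∏ j : Fin p, f (σ j.succ)) ^ (b + 1),
    mul_mem_of_mem hv (pow_mem_of_mem (prod_mem_graded hf fun j : Fin p => σ j.succ) _) ?_, ?_⟩
  · have : (b + 1) * (p + 1) = b + (b + 1) * p + 1 := by ring
    omega
  · rw [Fin.prod_univ_succ, mul_pow, hxv, mul_assoc]

/-- If `x` divides all elements of a large degree, it acts surjectively on the cochains of positive
cohomological degree. -/
theorem exists_smul_eq_cochain {x : S} {b : ℕ} (hf : ∀ i, f i ∈ 𝒮 1)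
    (hx : ∀ u ∈ 𝒮 (b + 1), ∃ v ∈ 𝒮 b, u = x * v) {p : ℕ} {n : ℤ} {c : CechCochain f S (p + 1)}
    (hc : c ∈ cechPiece f 𝒮 (p + 1) n) : ∃ c' ∈ cechPiece f 𝒮 (p + 1) (n - 1), x • c' = c := by
  rw [mem_cechPiece_iff] at hc
  have : ∀ σ : Fin (p + 1) → ι, ∃ z ∈ localizationPiece 𝒮 (∏ j, f (σ j)) ((p + 1 : ℕ)) (n - 1),
      x • z = c σ := by
    intro σ
    obtain ⟨w, hw, hxw⟩ := exists_mul_eq_prod_pow hf hx σ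
    refine exists_smul_eq_of_mul_eq_pow (prod_mem_graded hf σ) hw ?_ hxw (hc σ)
    have : 0 < (b + 1) * (p + 1) := by positivity
    omega
  choose c' hc' hxc' using this
  exact ⟨c', mem_cechPiece_iff.mpr hc', funext hxc'⟩

theorem exists_pow_smul_eq_cochain {x : S} {b : ℕ} (hf : ∀ i, f i ∈ 𝒮 1)
    (hx : ∀ u ∈ 𝒮 (b + 1), ∃ v ∈ 𝒮 b, u = x * v) {p : ℕ} (L : ℕ) {n : ℤ}
    {c : CechCochain f S (p + 1)} (hc : c ∈ cechPiece f 𝒮 (p + 1) (n + L)) :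
    ∃ c' ∈ cechPiece f 𝒮 (p + 1) n, x ^ L • c' = c := by
  induction L generalizing c with
  | zero => exact ⟨c, by simpa using hc, by simp⟩
  | succ L ih =>
    obtain ⟨c₁, hc₁, rfl⟩ := exists_smul_eq_cochain hf hx hc
    rw [show n + ((L + 1 : ℕ) : ℤ) - 1 = n + L by push_cast; ring] at hc₁
    obtain ⟨c', hc', rfl⟩ := ih hc₁
    exact ⟨c', hc', by rw [pow_succ', mul_smul]⟩

theorem smul_injective_cochain {x : S} {b : ℕ} (hf : ∀ i, f i ∈ 𝒮 1)
    (hx : ∀ u ∈ 𝒮 (b + 1), ∃ v ∈ 𝒮 b, u = x * v) {p : ℕ} {c : CechCochain f S (p + 1)}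
    (hc : x • c = 0) : c = 0 := by
  funext σ
  obtain ⟨w, -, hxw⟩ := exists_mul_eq_prod_pow hf hx σ
  exact smul_injective_of_mul_eq_pow hxw (congrFun hc σ)

theorem pow_smul_injective_cochain {x : S} {b : ℕ} (hf : ∀ i, f i ∈ 𝒮 1)
    (hx : ∀ u ∈ 𝒮 (b + 1), ∃ v ∈ 𝒮 b, u = x * v) {p : ℕ} (L : ℕ) {c : CechCochain f S (p + 1)}
    (hc : x ^ L • c = 0) : c = 0 := by
  induction L with
  | zero => simpa using hc
  | succ L ih => exact ih (smul_injective_cochain hf hx (by rwa [pow_succ', mul_smul] at hc))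

end Cochains

/-! ### Čech cochains of cohomological degree zero -/

section DegreeZero

variable {S : Type*} [CommRing S] {𝒮 : ℕ → AddSubgroup S} {ι : Type*} {f : ι → S}

/-- The Čech cochain of cohomological degree zero given by an element of the ring. -/
def cechConst (f : ι → S) (m : S) : CechCochain f S 0 := fun _ => frac _ 0 m

theorem cechConst_eq_zero_iff {m : S} : cechConst f m = 0 ↔ m = 0 := by
  constructor
  · intro h
    obtain ⟨j, hj⟩ := frac_eq_zero_iff.mp (congrFun h Fin.elim0)
    simpa using hj
  · rintro rfl
    exact funext fun _ => frac_zero _ _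

theorem smul_cechConst (a m : S) : a • cechConst f m = cechConst f (a * m) :=
  funext fun _ => smul_frac _ _ _ _

theorem cechDiff_cechConst (m : S) (σ : Fin 1 → ι) :
    cechDiff f S 0 (cechConst f m) σ = frac _ 0 m := by
  rw [cechDiff_apply, Fin.sum_univ_succ]
  simp only [Finset.univ_eq_empty, Finset.sum_empty, add_zero, Fin.val_zero, pow_zero, one_smul,
    cechConst]
  exact localizationMap_frac_zero _ m

theorem cechDiff_cechDiff_cechConst (m : S) :
    cechDiff f S 1 (cechDiff f S 0 (cechConst f m)) = 0 := by
  funext σ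
  rw [cechDiff_apply]
  simp_rw [cechDiff_cechConst, localizationMap_frac_zero]
  rw [Fin.sum_univ_succ, Fin.sum_univ_succ]
  simp

theorem cechDiff_cechConst_eq_zero_iff {m : S} :
    cechDiff f S 0 (cechConst f m) = 0 ↔ ∀ i, ∃ j, f i ^ j * m = 0 := by
  constructor
  · intro h i
    have := congrFun h fun _ => i
    rw [cechDiff_cechConst] at this
    obtain ⟨j, hj⟩ := frac_eq_zero_iff.mp this
    exact ⟨j, by simpa using hj⟩
  · intro h
    funext σ
    rw [cechDiff_cechConst]
    obtain ⟨j, hj⟩ := h (σ 0)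
    exact frac_eq_zero_iff.mpr ⟨j, by simpa using hj⟩

theorem cechConst_mem_cechPiece {m : S} {e : ℕ} (hm : m ∈ 𝒮 e) :
    cechConst f m ∈ cechPiece f 𝒮 0 e :=
  mem_cechPiece_iff.mpr fun _ => frac_mem_localizationPiece hm (by simp)

variable [SetLike.GradedMonoid 𝒮]

theorem exists_eq_cechConst {n : ℤ} {c : CechCochain f S 0} (hc : c ∈ cechPiece f 𝒮 0 n) :
    ∃ m, c = cechConst f m ∧ (m = 0 ∨ ∃ e : ℕ, m ∈ 𝒮 e ∧ (e : ℤ) = n) := by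
  have h1 : ∏ j, f ((Fin.elim0 : Fin 0 → ι) j) ∈ 𝒮 0 := by
    simpa using SetLike.one_mem_graded 𝒮
  have hext : ∀ m, c Fin.elim0 = frac _ 0 m → c = cechConst f m := by
    intro m hm
    funext σ
    obtain rfl : σ = Fin.elim0 := Subsingleton.elim _ _
    exact hm
  obtain h | ⟨k, e, m, hm, he, h⟩ := eq_zero_or_eq_frac_of_mem h1 (mem_cechPiece_iff.mp hc Fin.elim0)
  · exact ⟨0, hext 0 (h.trans (frac_zero _ _).symm), .inl rfl⟩
  · refine ⟨m, hext m (h.trans ?_), .inr ⟨e, hm, by simpa using he⟩⟩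
    simpa using (pow_smul_frac (∏ j, f ((Fin.elim0 : Fin 0 → ι) j)) k m)

end DegreeZero

/-! ### Regularity of a graded ring in which x generates high degrees -/

section Regularity

variable {S : Type*} [CommRing S] {𝒮 : ℕ → AddSubgroup S} {ι : Type*} {f : ι → S}

theorem le_regularity {p : ℕ} {n : ℤ}
    (h : ¬ cechCocycles f 𝒮 p n ≤ cechCoboundaries f 𝒮 p n) :
    (((n + p : ℤ) : ℝ) : EReal) ≤ regularity f 𝒮 := by
  have h1 : ((n : ℝ) : EReal) ≤ aInvariant f 𝒮 p :=
    le_iSup₂_of_le n (nontrivial_localCohomologyPiece_iff.mpr h) le_rfl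
  refine le_trans ?_ (le_iSup (fun i : ℕ => aInvariant f 𝒮 i + ((i : ℝ) : EReal)) p)
  push_cast
  gcongr

theorem regularity_le {B : EReal} (h : ∀ (p : ℕ) (n : ℤ),
    ¬ cechCocycles f 𝒮 p n ≤ cechCoboundaries f 𝒮 p n → (((n + p : ℤ) : ℝ) : EReal) ≤ B) :
    regularity f 𝒮 ≤ B := by
  refine iSup_le fun p => ?_
  -- Moving the finite summand p to the right lets the supremum be bounded termwise, also when it is
  -- empty and equals -∞.
  rw [← EReal.le_sub_iff_add_le (.inl (EReal.coe_ne_bot _)) (.inl (EReal.coe_ne_top _))]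
  refine iSup₂_le fun n hn => ?_
  rw [EReal.le_sub_iff_add_le (.inl (EReal.coe_ne_bot _)) (.inl (EReal.coe_ne_top _))]
  have := h p n (nontrivial_localCohomologyPiece_iff.mp hn)
  push_cast at this
  exact this

theorem exists_eq_pow_mul {x : S} {r : ℕ}
    (hr : ∀ n ≥ r, ∀ u ∈ 𝒮 (n + 1), ∃ v ∈ 𝒮 n, u = x * v) (L : ℕ) {n : ℕ}
    (hn : r ≤ n) {u : S} (hu : u ∈ 𝒮 (n + L)) : ∃ v ∈ 𝒮 n, u = x ^ L * v := by
  induction L generalizing u with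
  | zero => exact ⟨u, hu, by simp⟩
  | succ L ih =>
    obtain ⟨v, hv, rfl⟩ := hr (n + L) (by omega) u hu
    obtain ⟨w, hw, rfl⟩ := ih hv
    exact ⟨w, hw, by ring⟩

variable [GradedRing 𝒮] [Fintype ι]

/-- A homogeneous element of the ideal generated by powers of the elements `f i` is a combination
of these with homogeneous coefficients. -/
theorem exists_homogeneous_coeff (hf : ∀ i, f i ∈ 𝒮 1) (k : ι → ℕ) {y : S} {L : ℕ} (hy : y ∈ 𝒮 L)
    (h : y ∈ Ideal.span (Set.range fun i => f i ^ k i)) :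
    ∃ a : ι → S, (∀ i, a i = 0 ∨ ∃ b, a i ∈ 𝒮 b ∧ b + k i = L) ∧ y = ∑ i, a i * f i ^ k i := by
  obtain ⟨c, rfl⟩ := (Submodule.mem_span_range_iff_exists_fun S).mp h
  simp only [smul_eq_mul] at hy ⊢
  classical
  -- The coefficient is the component of c i in degree L - k i. The case k i > L is set to zero,
  -- since truncated subtraction would select degree 0.
  refine ⟨fun i => if k i ≤ L then (DirectSum.decompose 𝒮 (c i) (L - k i) : S) else 0, ?_, ?_⟩
  · intro i
    by_cases hi : k i ≤ L
    · exact .inr ⟨L - k i, by simp only [hi, if_true]; exact SetLike.coe_mem _,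
        Nat.sub_add_cancel hi⟩
    · simp [hi]
  · conv_lhs => rw [← DirectSum.decompose_of_mem_same 𝒮 hy]
    rw [DirectSum.decompose_sum, DFinsupp.finsetSum_apply, AddSubmonoidClass.coe_finsetSum]
    refine Finset.sum_congr rfl fun i _ => ?_
    have hi : f i ^ k i ∈ 𝒮 (k i) := by simpa using pow_mem_of_mem (hf i) (k i)
    rw [DirectSum.coe_decompose_mul_of_right_mem 𝒮 L hi]
    by_cases h : k i ≤ L <;> simp [h]

/-- The f i generate S₊, so x lies in the radical of the ideal generated by any prescribed powers of
them. -/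
theorem exists_pow_eq_sum (hf : IsGeneratingSystem 𝒮 f) {x : S} (hx : x ∈ 𝒮 1) (k : ι → ℕ) :
    ∃ (L : ℕ) (a : ι → S), (∀ i, a i = 0 ∨ ∃ b, a i ∈ 𝒮 b ∧ b + k i = L) ∧
      x ^ L = ∑ i, a i * f i ^ k i := by
  have : x ∈ (Ideal.span (Set.range fun i => f i ^ k i)).radical := by
    have hle : Ideal.span (Set.range f) ≤ (Ideal.span (Set.range fun i => f i ^ k i)).radical := by
      rw [Ideal.span_le]
      rintro _ ⟨i, rfl⟩
      exact ⟨k i, Ideal.subset_span ⟨i, rfl⟩⟩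
    apply hle
    rw [hf.span_eq]
    exact Ideal.subset_span ⟨1, le_rfl, hx⟩
  obtain ⟨L, hL⟩ := this
  obtain ⟨a, ha⟩ := exists_homogeneous_coeff hf.mem k (by simpa using pow_mem_of_mem hx L) hL
  exact ⟨L, a, ha⟩

/-- The cone constructions for the various vertices i are combined with the coefficients of x ^ L =
∑ a i * f i ^ k i. -/
theorem exists_cechDiff_eq_pow_smul_of_mem (hf : IsGeneratingSystem 𝒮 f) {x : S} (hx : x ∈ 𝒮 1)
    {p : ℕ} {n : ℤ} {c : CechCochain f S (p + 1)} (hc : c ∈ cechCocycles f 𝒮 (p + 1) n) :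
    ∃ L : ℕ, ∃ u ∈ cechPiece f 𝒮 p (n + L), cechDiff f S p u = x ^ L • c := by
  choose k u hu hdu using fun i => exists_cechDiff_eq_pow_smul hf.mem i hc
  obtain ⟨L, a, ha, hL⟩ := exists_pow_eq_sum hf hx k
  refine ⟨L, ∑ i, a i • u i, sum_mem fun i _ => ?_, ?_⟩
  · obtain h | ⟨b, hb, hbL⟩ := ha i
    · rw [h, zero_smul]; exact zero_mem _
    · have := smul_mem_cechPiece hf.mem hb (hu i)
      rwa [← hbL, Nat.cast_add, add_comm (b : ℤ), ← add_assoc]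
  · rw [map_sum, hL, Finset.sum_smul]
    refine Finset.sum_congr rfl fun i _ => ?_
    rw [map_smul, hdu, mul_smul]

variable {x : S} {r : ℕ}

/-- Some power of x lies in the ideal of any given powers of the f i, and x divides a power of each
f i. Thus H^0 is the x-torsion. -/
theorem forall_exists_pow_mul_eq_zero_iff (hf : IsGeneratingSystem 𝒮 f) (hx : x ∈ 𝒮 1)
    (hr : ∀ n ≥ r, ∀ u ∈ 𝒮 (n + 1), ∃ v ∈ 𝒮 n, u = x * v) {m : S} :
    (∀ i, ∃ j, f i ^ j * m = 0) ↔ ∃ k, x ^ k * m = 0 := by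
  constructor
  · intro h
    choose j hj using h
    obtain ⟨L, a, -, hL⟩ := exists_pow_eq_sum hf hx j
    refine ⟨L, ?_⟩
    rw [hL, Finset.sum_mul]
    exact Finset.sum_eq_zero fun i _ => by rw [mul_assoc, hj, mul_zero]
  · rintro ⟨k, hk⟩ i
    obtain ⟨v, -, hv⟩ := hr r le_rfl (f i ^ (r + 1))
      (by simpa using pow_mem_of_mem (hf.mem i) (r + 1))
    refine ⟨(r + 1) * k, ?_⟩
    rw [pow_mul, hv, mul_pow, mul_assoc, mul_left_comm, hk, mul_zero]

/-- If x ^ L c = d u, then u has positive cohomological degree and can be divided by x ^ L;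
injectivity of x ^ L then gives c = d (u / x ^ L). -/
theorem cechCocycles_le_of_two_le (hf : IsGeneratingSystem 𝒮 f) (hx : x ∈ 𝒮 1)
    (hr : ∀ n ≥ r, ∀ u ∈ 𝒮 (n + 1), ∃ v ∈ 𝒮 n, u = x * v) (p : ℕ) (n : ℤ) :
    cechCocycles f 𝒮 (p + 2) n ≤ cechCoboundaries f 𝒮 (p + 2) n := by
  intro c hc
  obtain ⟨L, u, hu, hdu⟩ := exists_cechDiff_eq_pow_smul_of_mem hf hx hc
  obtain ⟨v, hv, rfl⟩ := exists_pow_smul_eq_cochain hf.mem (hr r le_rfl) L hu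
  refine mem_cechCoboundaries_succ_iff.mpr ⟨v, hv, ?_⟩
  rw [← sub_eq_zero]
  apply pow_smul_injective_cochain hf.mem (hr r le_rfl) L
  rw [smul_sub, ← hdu, map_smul, sub_self]

/-- The same division argument, but u is now a ring element of degree n + L, which x ^ L is known to
divide only because n ≥ r. -/
theorem cechCocycles_one_le (hf : IsGeneratingSystem 𝒮 f) (hx : x ∈ 𝒮 1)
    (hr : ∀ n ≥ r, ∀ u ∈ 𝒮 (n + 1), ∃ v ∈ 𝒮 n, u = x * v) {n : ℤ} (hn : r ≤ n) :
    cechCocycles f 𝒮 1 n ≤ cechCoboundaries f 𝒮 1 n := by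
  intro c hc
  obtain ⟨L, u, hu, hdu⟩ := exists_cechDiff_eq_pow_smul_of_mem hf hx hc
  lift n to ℕ using by omega
  obtain ⟨m, rfl, hm⟩ := exists_eq_cechConst hu
  have hm' : m ∈ 𝒮 (n + L) := by
    obtain rfl | ⟨e, he, hen⟩ := hm
    · exact zero_mem _
    · obtain rfl : e = n + L := by exact_mod_cast hen
      exact he
  obtain ⟨v, hv, rfl⟩ := exists_eq_pow_mul hr L (by exact_mod_cast hn) hm'
  refine mem_cechCoboundaries_succ_iff.mpr ⟨cechConst f v, cechConst_mem_cechPiece hv, ?_⟩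
  rw [← sub_eq_zero]
  apply pow_smul_injective_cochain hf.mem (hr r le_rfl) L
  rw [smul_sub, ← hdu, ← smul_cechConst, map_smul, sub_self]

/-- The regularity is bounded by `r` and the degrees of the `x`-torsion elements. -/
theorem regularity_le_of_torsion (hf : IsGeneratingSystem 𝒮 f) (hx : x ∈ 𝒮 1)
    (hr : ∀ n ≥ r, ∀ u ∈ 𝒮 (n + 1), ∃ v ∈ 𝒮 n, u = x * v) {B : EReal} (hrB : ((r : ℝ) : EReal) ≤ B)
    (htors : ∀ (n k : ℕ) (u : S), u ∈ 𝒮 n → x ^ k * u = 0 → u ≠ 0 → ((n : ℝ) : EReal) ≤ B) :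
    regularity f 𝒮 ≤ B := by
  refine regularity_le fun p n h => ?_
  match p with
  | 0 =>
    obtain ⟨c, hc, hc0⟩ := SetLike.not_le_iff_exists.mp h
    obtain ⟨hdc, hcp⟩ := mem_cechCocycles_iff.mp hc
    obtain ⟨m, rfl, hm⟩ := exists_eq_cechConst hcp
    have hm0 : m ≠ 0 := fun h0 => hc0 (cechConst_eq_zero_iff.mpr h0)
    obtain ⟨e, he, rfl⟩ := hm.resolve_left hm0
    obtain ⟨k, hk⟩ := (forall_exists_pow_mul_eq_zero_iff hf hx hr).mp
      (cechDiff_cechConst_eq_zero_iff.mp hdc)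
    simpa using htors e k m he hk hm0
  | 1 =>
    have hn : n + 1 ≤ r := by
      by_contra hn
      exact h (cechCocycles_one_le hf hx hr (by omega))
    refine le_trans ?_ hrB
    have : ((n + 1 : ℤ) : ℝ) ≤ r := by exact_mod_cast hn
    exact EReal.coe_le_coe_iff.mpr (by simpa using this)
  | p + 2 => exact absurd (cechCocycles_le_of_two_le hf hx hr p n) h

theorem le_regularity_of_torsion (hf : IsGeneratingSystem 𝒮 f) (hx : x ∈ 𝒮 1)
    (hr : ∀ n ≥ r, ∀ u ∈ 𝒮 (n + 1), ∃ v ∈ 𝒮 n, u = x * v) {n k : ℕ} {u : S} (hu : u ∈ 𝒮 n)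
    (hk : x ^ k * u = 0) (hu0 : u ≠ 0) : ((n : ℝ) : EReal) ≤ regularity f 𝒮 := by
  have := le_regularity (f := f) (𝒮 := 𝒮) (p := 0) (n := n) fun h =>
    hu0 <| cechConst_eq_zero_iff.mp <| h <| mem_cechCocycles_iff.mpr
      ⟨cechDiff_cechConst_eq_zero_iff.mpr
        ((forall_exists_pow_mul_eq_zero_iff hf hx hr).mpr ⟨k, hk⟩), cechConst_mem_cechPiece hu⟩
  simpa using this

/-- If `x` does not generate in degree `r` (respectively, if `r = 0`), then `r ≤ reg S`. -/
theorem le_regularity_of_minimal [Nontrivial S] (hf : IsGeneratingSystem 𝒮 f) (hx : x ∈ 𝒮 1)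
    (hr : ∀ n ≥ r, ∀ u ∈ 𝒮 (n + 1), ∃ v ∈ 𝒮 n, u = x * v)
    (hmin : ∀ n, n + 1 = r → ∃ u ∈ 𝒮 r, ∀ v ∈ 𝒮 n, u ≠ x * v) :
    ((r : ℝ) : EReal) ≤ regularity f 𝒮 := by
  -- Degree r - 1 is taken in ℤ, so that r = 0 is covered with u = 1: only v = 0 has degree -1.
  obtain ⟨u, hu, hu'⟩ : ∃ u ∈ 𝒮 r, ∀ v, (v = 0 ∨ ∃ e : ℕ, v ∈ 𝒮 e ∧ (e : ℤ) = r - 1) →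
      u ≠ x * v := by
    obtain _ | r := r
    · refine ⟨1, SetLike.one_mem_graded 𝒮, ?_⟩
      rintro v (rfl | ⟨e, -, he⟩)
      · simp
      · omega
    · obtain ⟨u, hu, h⟩ := hmin r rfl
      refine ⟨u, hu, ?_⟩
      rintro v (rfl | ⟨e, hv, he⟩)
      · exact h 0 (zero_mem _)
      · obtain rfl : e = r := by push_cast at he; omega
        exact h v hv
  by_cases h1 : cechCocycles f 𝒮 1 (r - 1) ≤ cechCoboundaries f 𝒮 1 (r - 1)
  · have huc : cechDiff f S 0 (cechConst f u) ∈ cechPiece f 𝒮 1 r :=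
      mem_cechPiece_iff.mpr fun σ => by
        rw [cechDiff_cechConst]
        exact frac_mem_localizationPiece hu (by simp)
    -- The cochain c is u / x. It is a cocycle, so vanishing of H^1 in degree r - 1 makes it the
    -- image of some v, and u - x v is torsion.
    obtain ⟨c, hc, hxc⟩ := exists_smul_eq_cochain hf.mem (hr r le_rfl) huc
    have hdc : cechDiff f S 1 c = 0 := by
      apply smul_injective_cochain hf.mem (hr r le_rfl)
      rw [← map_smul, hxc, cechDiff_cechDiff_cechConst]
    obtain ⟨w, hw, hdw⟩ := mem_cechCoboundaries_succ_iff.mp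
      (h1 (mem_cechCocycles_iff.mpr ⟨hdc, hc⟩))
    obtain ⟨v, rfl, hv⟩ := exists_eq_cechConst hw
    have hxv : x * v ∈ 𝒮 r := by
      obtain rfl | ⟨e, he, her⟩ := hv
      · simp
      · exact mul_mem_of_mem hx he (by omega)
    have h0 : cechDiff f S 0 (cechConst f (u - x * v)) = 0 := by
      have : cechConst f (u - x * v) = cechConst f u - x • cechConst f v := by
        rw [smul_cechConst]
        exact funext fun _ => frac_sub _ _ _ _
      rw [this, map_sub, map_smul, hdw, hxc, sub_self]
    obtain ⟨k, hk⟩ := (forall_exists_pow_mul_eq_zero_iff hf hx hr).mp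
      (cechDiff_cechConst_eq_zero_iff.mp h0)
    exact le_regularity_of_torsion hf hx hr (sub_mem hu hxv) hk (sub_ne_zero.mpr (hu' v hv))
  · simpa using le_regularity h1

end Regularity

/-! ### A criterion for an internal direct sum -/

section Grading

theorem isInternal_of_sum {S : Type*} [AddCommGroup S] {𝒮 : ℕ → AddSubgroup S}
    (hsurj : ∀ u, ∃ (s : Finset ℕ) (w : ℕ → S), (∀ n, w n ∈ 𝒮 n) ∧ u = ∑ n ∈ s, w n)
    (hinj : ∀ (s : Finset ℕ) (w : ℕ → S), (∀ n, w n ∈ 𝒮 n) → ∑ n ∈ s, w n = 0 →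
      ∀ n ∈ s, w n = 0) : DirectSum.IsInternal 𝒮 := by
  classical
  constructor
  · rw [injective_iff_map_eq_zero]
    intro z hz
    rw [DirectSum.coeAddMonoidHom_eq_dfinsuppSum, DFinsupp.sum] at hz
    refine DFinsupp.ext fun n => ?_
    by_cases hn : n ∈ DFinsupp.support z
    · exact Subtype.ext (hinj _ (fun n => (z n : S)) (fun n => (z n).2) hz n hn)
    · simpa using hn
  · intro u
    obtain ⟨s, w, hw, rfl⟩ := hsurj u
    refine ⟨∑ n ∈ s, DirectSum.of (fun n => 𝒮 n) n ⟨w n, hw n⟩, ?_⟩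
    rw [map_sum]
    simp_rw [DirectSum.coeAddMonoidHom_of]

end Grading

/-! ### The extension of J to the Rees algebra -/

section ReesQuotient

variable {A : Type*} [CommRing A] {I : Ideal A} (J : Ideal A)

theorem coeff_mem_of_mem_map {x : reesAlgebra I}
    (hx : x ∈ J.map (algebraMap A (reesAlgebra I))) : ∀ n, (x : A[X]).coeff n ∈ J * I ^ n := by
  refine Submodule.span_induction (R := reesAlgebra I)
    (p := fun (x : reesAlgebra I) _ => ∀ n, (x : A[X]).coeff n ∈ J * I ^ n) ?_ ?_ ?_ ?_ hx
  · rintro _ ⟨a, ha, rfl⟩ n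
    rw [Subalgebra.coe_algebraMap, Polynomial.algebraMap_apply, coeff_C]
    split_ifs with h
    · subst h; simpa using ha
    · exact zero_mem _
  · intro n
    simp
  · intro x y _ _ hx hy n
    simpa using add_mem (hx n) (hy n)
  · intro c x _ hx n
    rw [smul_eq_mul, Subalgebra.coe_mul, coeff_mul]
    refine sum_mem fun ij hij => ?_
    rw [← Finset.HasAntidiagonal.mem_antidiagonal.mp hij, pow_add, mul_left_comm]
    exact Ideal.mul_mem_mul (c.2 _) (hx _)

theorem monomial_mem_map {n : ℕ} {a : A} (ha : a ∈ J * I ^ n) {y : reesAlgebra I}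
    (hy : (y : A[X]) = monomial n a) : y ∈ J.map (algebraMap A (reesAlgebra I)) := by
  suffices h : ∃ y ∈ J.map (algebraMap A (reesAlgebra I)), (y : A[X]) = monomial n a by
    obtain ⟨z, hz, hza⟩ := h
    rwa [show y = z from Subtype.ext (hy.trans hza.symm)]
  refine Submodule.mul_induction_on ha (fun u hu v hv => ?_) (fun u v => ?_)
  · refine ⟨algebraMap A (reesAlgebra I) u * ⟨monomial n v, reesAlgebra.monomial_mem.mpr hv⟩,
      Ideal.mul_mem_right _ _ (Ideal.mem_map_of_mem _ hu), ?_⟩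
    simp [C_mul_monomial]
  · rintro ⟨y, hy, hyu⟩ ⟨z, hz, hzv⟩
    exact ⟨y + z, add_mem hy hz, by simp [hyu, hzv]⟩

/-- The extended ideal is ⨁ J I ^ n t ^ n, so membership is tested on coefficients. -/
theorem mem_map_reesAlgebra_iff {x : reesAlgebra I} :
    x ∈ J.map (algebraMap A (reesAlgebra I)) ↔ ∀ n, (x : A[X]).coeff n ∈ J * I ^ n := by
  refine ⟨coeff_mem_of_mem_map J, fun h => ?_⟩
  have hsum : x = ∑ n ∈ (x : A[X]).support, (⟨monomial n ((x : A[X]).coeff n),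
      reesAlgebra.monomial_mem.mpr (x.2 n)⟩ : reesAlgebra I) := by
    apply Subtype.ext
    conv_lhs => rw [(x : A[X]).as_sum_support]
    simp
  rw [hsum]
  exact sum_mem fun n _ => monomial_mem_map J (h n) rfl

end ReesQuotient

/-! ### Graded quotients of the Rees algebra, uniformly for F(I) and G(I) -/

section ReesModel

variable {A : Type*} [CommRing A] {I J : Ideal A} {S : Type*} [CommRing S]

/-- The ring homomorphism `π` presents `S` as the quotient `R(I) / J R(I)`. -/
structure IsReesQuotient (J : Ideal A) (π : reesAlgebra I →+* S) : Prop where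
  surjective : Function.Surjective π
  map_eq_zero_iff : ∀ x, π x = 0 ↔ x ∈ J.map (algebraMap A (reesAlgebra I))

/-- The image of `I ^ n t ^ n` in a quotient of the Rees algebra. -/
abbrev reesImage (π : reesAlgebra I →+* S) (n : ℕ) : AddSubgroup S :=
  (reesPiece I n).map π.toAddMonoidHom

/-- The image of `a t ^ n`, for `a ∈ I ^ n`, in a quotient of the Rees algebra. -/
def reesClass (π : reesAlgebra I →+* S) (n : ℕ) {a : A} (ha : a ∈ I ^ n) : S :=
  π ⟨monomial n a, reesAlgebra.monomial_mem.mpr ha⟩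

variable (π : reesAlgebra I →+* S)

theorem IsReesQuotient.reesClass_eq_zero_iff {π : reesAlgebra I →+* S} (hπ : IsReesQuotient J π)
    {n : ℕ} {a : A} (ha : a ∈ I ^ n) : reesClass π n ha = 0 ↔ a ∈ J * I ^ n := by
  rw [reesClass, hπ.map_eq_zero_iff, mem_map_reesAlgebra_iff]
  constructor
  · intro h
    simpa using h n
  · intro h m
    rw [coeff_monomial]
    split_ifs with hm
    · exact hm ▸ h
    · exact zero_mem _

theorem reesClass_congr {n m : ℕ} {a b : A} (ha : a ∈ I ^ n) (hb : b ∈ I ^ m) (hn : n = m)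
    (hab : a = b) : reesClass π n ha = reesClass π m hb := by
  subst hn hab; rfl

theorem reesClass_add {n : ℕ} {a b : A} (ha : a ∈ I ^ n) (hb : b ∈ I ^ n) :
    reesClass π n (add_mem ha hb) = reesClass π n ha + reesClass π n hb := by
  rw [reesClass, reesClass, reesClass, ← map_add]
  congr 1
  apply Subtype.ext
  simp

theorem reesClass_sub {n : ℕ} {a b : A} (ha : a ∈ I ^ n) (hb : b ∈ I ^ n) :
    reesClass π n (sub_mem ha hb) = reesClass π n ha - reesClass π n hb := by
  rw [reesClass, reesClass, reesClass, ← map_sub]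
  congr 1
  apply Subtype.ext
  simp

theorem mul_mem_pow_add {n m : ℕ} {a b : A} (ha : a ∈ I ^ n) (hb : b ∈ I ^ m) :
    a * b ∈ I ^ (n + m) := pow_add I n m ▸ Ideal.mul_mem_mul ha hb

theorem reesClass_mul {n m : ℕ} {a b : A} (ha : a ∈ I ^ n) (hb : b ∈ I ^ m) :
    reesClass π n ha * reesClass π m hb = reesClass π (n + m) (mul_mem_pow_add ha hb) := by
  rw [reesClass, reesClass, reesClass, ← map_mul]
  congr 1
  apply Subtype.ext
  simp [monomial_mul_monomial]

theorem algebraMap_mul_reesClass {n : ℕ} (c : A) {a : A} (ha : a ∈ I ^ n) :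
    π (algebraMap A (reesAlgebra I) c) * reesClass π n ha =
      reesClass π n (Ideal.mul_mem_left _ c ha) := by
  rw [reesClass, reesClass, ← map_mul]
  congr 1
  apply Subtype.ext
  simp [C_mul_monomial]

theorem reesClass_pow {n : ℕ} {a : A} (ha : a ∈ I ^ n) (k : ℕ) :
    reesClass π n ha ^ k =
      reesClass π (n * k) (show a ^ k ∈ I ^ (n * k) from pow_mul I n k ▸ Ideal.pow_mem_pow ha k) := by
  rw [reesClass, reesClass, ← map_pow]
  congr 1
  apply Subtype.ext
  simp [monomial_pow]

theorem reesClass_one (h : (1 : A) ∈ I ^ 0) : reesClass π 0 h = 1 := by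
  rw [reesClass, ← map_one π]
  congr 1

theorem mem_reesImage_iff {n : ℕ} {u : S} :
    u ∈ reesImage π n ↔ ∃ (a : A) (ha : a ∈ I ^ n), u = reesClass π n ha := by
  constructor
  · rintro ⟨x, ⟨a, ha, hx⟩, rfl⟩
    exact ⟨a, ha, congrArg π (Subtype.ext hx)⟩
  · rintro ⟨a, ha, rfl⟩
    exact ⟨_, ⟨a, ha, rfl⟩, rfl⟩

theorem reesClass_mem {n : ℕ} {a : A} (ha : a ∈ I ^ n) : reesClass π n ha ∈ reesImage π n :=
  (mem_reesImage_iff π).mpr ⟨a, ha, rfl⟩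

instance reesImage_gradedMonoid : SetLike.GradedMonoid (reesImage π) where
  one_mem := by
    rw [← reesClass_one π (by simp)]
    exact reesClass_mem π _
  mul_mem := by
    intro i j u v hu hv
    obtain ⟨a, ha, rfl⟩ := (mem_reesImage_iff π).mp hu
    obtain ⟨b, hb, rfl⟩ := (mem_reesImage_iff π).mp hv
    rw [reesClass_mul]
    exact reesClass_mem π _

variable {π}

theorem IsReesQuotient.isInternal (hπ : IsReesQuotient J π) :
    DirectSum.IsInternal (reesImage π) := by
  refine isInternal_of_sum (fun u => ?_) (fun s w hw hsum n hn => ?_)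
  · obtain ⟨x, rfl⟩ := hπ.surjective u
    refine ⟨(x : A[X]).support, fun n => reesClass π n (x.2 n), fun n => reesClass_mem π _, ?_⟩
    simp_rw [reesClass, ← map_sum]
    congr 1
    apply Subtype.ext
    conv_lhs => rw [(x : A[X]).as_sum_support]
    simp
  · choose a ha hwa using fun n => (mem_reesImage_iff π).mp (hw n)
    simp_rw [hwa, reesClass, ← map_sum] at hsum
    rw [hπ.map_eq_zero_iff, mem_map_reesAlgebra_iff] at hsum
    rw [hwa, hπ.reesClass_eq_zero_iff]
    simpa [finsetSum_coeff, coeff_monomial, hn] using hsum n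

/-- The grading of `R(I) / J R(I)`. -/
abbrev IsReesQuotient.gradedRing (hπ : IsReesQuotient J π) : GradedRing (reesImage π) where
  __ := hπ.isInternal.chooseDecomposition

theorem IsReesQuotient.nontrivial (hπ : IsReesQuotient J π) (hJ : J ≠ ⊤) : Nontrivial S := by
  refine ⟨1, 0, fun h => hJ ?_⟩
  rw [← reesClass_one π (by simp), hπ.reesClass_eq_zero_iff] at h
  rw [Ideal.eq_top_iff_one]
  simpa using h

/-- The class of `x t` divides all elements of degree `n + 1` iff `I ^ (n + 1) = x I ^ n`. -/
theorem IsReesQuotient.forall_exists_eq_mul_iff [IsLocalRing A] [IsNoetherianRing A]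
    (hπ : IsReesQuotient J π) (hJ : J ≠ ⊤) {x : A} (hx : x ∈ I ^ 1) (n : ℕ) :
    (∀ u ∈ reesImage π (n + 1), ∃ v ∈ reesImage π n, u = reesClass π 1 hx * v) ↔
      I ^ (n + 1) = Ideal.span {x} * I ^ n := by
  constructor
  · intro h
    apply le_antisymm
    · refine Submodule.le_of_le_smul_of_le_jacobson_bot (I := J) (IsNoetherian.noetherian _) ?_ ?_
      · rw [IsLocalRing.jacobson_eq_maximalIdeal _ bot_ne_top]
        exact IsLocalRing.le_maximalIdeal hJ
      · intro a ha
        obtain ⟨v, hv, h⟩ := h _ (reesClass_mem π ha)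
        obtain ⟨b, hb, rfl⟩ := (mem_reesImage_iff π).mp hv
        have hxb : x * b ∈ I ^ (n + 1) := by
          rw [add_comm]; exact mul_mem_pow_add hx hb
        rw [reesClass_mul, ← sub_eq_zero, reesClass_congr π _ hxb (add_comm _ _) rfl,
          ← reesClass_sub, hπ.reesClass_eq_zero_iff] at h
        rw [← add_sub_cancel (x * b) a]
        exact Submodule.add_mem_sup
          (Ideal.mul_mem_mul (Ideal.mem_span_singleton_self x) hb) h
    · rw [pow_succ']
      refine Ideal.mul_mono_left ?_
      rw [Ideal.span_singleton_le_iff_mem]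
      simpa using hx
  · intro h u hu
    obtain ⟨a, ha, rfl⟩ := (mem_reesImage_iff π).mp hu
    obtain ⟨b, hb, hab⟩ := Ideal.mem_span_singleton_mul.mp (h ▸ ha)
    refine ⟨_, reesClass_mem π hb, ?_⟩
    rw [reesClass_mul]
    exact reesClass_congr π _ _ (add_comm _ _) hab.symm

end ReesModel

/-! ### The irrelevant ideal in dimension at most one -/

section Irrelevant

variable {S : Type*} [CommRing S] {𝒮 : ℕ → AddSubgroup S} [GradedRing 𝒮]

theorem irrelevantIdeal_ne_top [Nontrivial S] : irrelevantIdeal 𝒮 ≠ ⊤ := by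
  intro h
  have hle : irrelevantIdeal 𝒮 ≤ (HomogeneousIdeal.irrelevant 𝒮).toIdeal := by
    rw [irrelevantIdeal, Ideal.span_le]
    rintro u ⟨n, hn, hu⟩
    exact DirectSum.decompose_of_mem_ne 𝒮 hu (by omega)
  have h1 : (1 : S) ∈ (HomogeneousIdeal.irrelevant 𝒮).toIdeal := hle (h ▸ Submodule.mem_top)
  have h2 : (DirectSum.decompose 𝒮 (1 : S) 0 : S) = 0 := h1
  rw [DirectSum.decompose_of_mem_same 𝒮 (SetLike.one_mem_graded 𝒮)] at h2
  exact one_ne_zero h2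

theorem sub_decompose_zero_mem (b : S) :
    b - (DirectSum.decompose 𝒮 b 0 : S) ∈ irrelevantIdeal 𝒮 := by
  induction b using DirectSum.Decomposition.inductionOn 𝒮 with
  | zero => simp
  | @homogeneous i m =>
    obtain rfl | hi := Nat.eq_zero_or_pos i
    · rw [DirectSum.decompose_of_mem_same 𝒮 m.2, sub_self]
      exact zero_mem _
    · rw [DirectSum.decompose_of_mem_ne 𝒮 m.2 (by omega), sub_zero]
      exact Ideal.subset_span ⟨i, hi, m.2⟩
  | add a b ha hb =>
    rw [DirectSum.decompose_add, DirectSum.add_apply, AddMemClass.coe_add, add_sub_add_comm]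
    exact add_mem ha hb

/-- In a graded ring of dimension at most one with `S₀` a field, an element of degree one that lies
in no minimal prime except possibly `S₊` generates `S₊` up to radical. -/
theorem irrelevantIdeal_le_radical [Nontrivial S] [Ring.KrullDimLE 1 S]
    (h0 : ∀ u ∈ 𝒮 0, u = 0 ∨ IsUnit u) {x : S} {d : ℕ} (hx : x ∈ 𝒮 d)
    (hmin : ∀ p ∈ minimalPrimes S, irrelevantIdeal 𝒮 ≤ p ∨ x ∉ p) :
    irrelevantIdeal 𝒮 ≤ (Ideal.span {x}).radical := by
  rw [Ideal.radical_eq_sInf]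
  refine le_sInf fun q ⟨hxq, hq⟩ => ?_
  refine le_trans ?_ (Ideal.toIdeal_homogeneousCore_le 𝒮 q)
  -- The homogeneous core of q is still prime and still contains the homogeneous element x.
  have hprime := hq.homogeneousCore (𝒜 := 𝒮)
  have hx' : x ∈ (q.homogeneousCore 𝒮).toIdeal :=
    Ideal.mem_homogeneousCore_of_homogeneous_of_mem ⟨d, hx⟩
      (hxq (Ideal.mem_span_singleton_self x))
  obtain h | h := Ring.krullDimLE_one_iff.mp inferInstance _ hprime
  · exact (hmin _ h).resolve_right (not_not.mpr hx')
  -- For a maximal core, degree-zero components of its elements are non-units, hence zero; so the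
  -- core lies in S₊ and equals it.
  · refine (h.eq_of_le irrelevantIdeal_ne_top fun b hb => ?_).ge
    have hb0 := (q.homogeneousCore 𝒮).isHomogeneous 0 hb
    obtain h1 | h1 := h0 _ (SetLike.coe_mem (DirectSum.decompose 𝒮 b 0))
    · have := sub_decompose_zero_mem (𝒮 := 𝒮) b
      rwa [h1, sub_zero] at this
    · exact absurd (Ideal.eq_top_of_isUnit_mem _ hb0 h1) hprime.ne_top

end Irrelevant

/-! ### Avoidance over an infinite residue field -/

section Avoidance

variable {A : Type*} [CommRing A] [IsLocalRing A] [Infinite (IsLocalRing.ResidueField A)]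

/-- A module over a local ring with infinite residue field is not a finite union of proper
submodules. -/
theorem exists_forall_notMem_of_ne_top {M : Type*} [AddCommGroup M] [Module A M] {ι : Type*}
    (s : Finset ι) (W : ι → Submodule A M) (hW : ∀ i ∈ s, W i ≠ ⊤) : ∃ x, ∀ i ∈ s, x ∉ W i := by
  by_contra! h
  have hcov : ⋃ i ∈ s, (W i : Set M) = Set.univ := by
    ext x
    simpa using h x
  -- In a finite cover by submodules one has finite index. For v outside it, A modulo the
  -- annihilator of the class of v is finite and maps onto the residue field.
  obtain ⟨i, hi, hfin⟩ := Submodule.exists_finiteIndex_of_cover hcov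
  obtain ⟨v, hv⟩ : ∃ v, v ∉ W i := by
    by_contra! hv
    exact hW i hi ((Submodule.eq_top_iff').mpr hv)
  have : Finite (M ⧸ W i) := AddSubgroup.finite_quotient_of_finiteIndex
  let φ : A →ₗ[A] M ⧸ W i := LinearMap.toSpanSingleton A _ (Submodule.Quotient.mk v)
  have hfinA : Finite (A ⧸ LinearMap.ker φ) :=
    Finite.of_injective _ (LinearMap.ker_eq_bot.mp (Submodule.ker_liftQ_eq_bot _ φ le_rfl le_rfl))
  have hle : LinearMap.ker φ ≤ IsLocalRing.maximalIdeal A := by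
    refine IsLocalRing.le_maximalIdeal fun htop => hv ?_
    have h1 : (1 : A) ∈ LinearMap.ker φ := htop ▸ Submodule.mem_top
    simpa [φ, Submodule.Quotient.mk_eq_zero] using h1
  have : Finite (IsLocalRing.ResidueField A) :=
    Finite.of_surjective _ (Ideal.Quotient.factor_surjective hle)
  exact _root_.not_finite (IsLocalRing.ResidueField A)

/-- If `M` is a module of elements of degree one that generate `S₊` up to radical, `dim S ≤ 1` and
`S₀` is a field, then some element of `M` generates `S` in high degrees. -/
theorem exists_eq_mul_of_mem_irrelevantIdeal_pow {S : Type*} [CommRing S] [Nontrivial S]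
    [IsNoetherianRing S] [Ring.KrullDimLE 1 S] [Algebra A S] {𝒮 : ℕ → AddSubgroup S} [GradedRing 𝒮]
    (h0 : ∀ u ∈ 𝒮 0, u = 0 ∨ IsUnit u) {M : Type*} [AddCommGroup M] [Module A M] (φ : M →ₗ[A] S)
    (hφ : ∀ m, φ m ∈ 𝒮 1)
    (hp : ∀ p : Ideal S, p.IsPrime → (∀ m, φ m ∈ p) → irrelevantIdeal 𝒮 ≤ p) :
    ∃ (m : M) (N : ℕ), ∀ u ∈ 𝒮 (N + 1), u ∈ irrelevantIdeal 𝒮 ^ (N + 1) →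
      ∃ v ∈ 𝒮 N, u = φ m * v := by
  classical
  have hfin := minimalPrimes.finite_of_isNoetherianRing S
  -- The submodules to avoid are the preimages of the finitely many minimal primes not containing
  -- S₊; they are proper by `hp`.
  obtain ⟨x, hx⟩ := exists_forall_notMem_of_ne_top
    (hfin.toFinset.filter fun p => ¬ irrelevantIdeal 𝒮 ≤ p)
    (fun p => (p.restrictScalars A).comap φ) (by
      intro p hpmem htop
      rw [Finset.mem_filter, Set.Finite.mem_toFinset] at hpmem
      refine hpmem.2 (hp p hpmem.1.1.1 fun m => ?_)
      have : m ∈ (p.restrictScalars A).comap φ := htop ▸ Submodule.mem_top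
      exact this)
  have hrad := irrelevantIdeal_le_radical h0 (hφ x)
    (fun p hpmem => or_iff_not_imp_left.mpr fun hle => hx p (by simp [hpmem, hle]))
  obtain ⟨N, hN⟩ := Ideal.exists_pow_le_of_le_radical_of_fg hrad (IsNoetherian.noetherian _)
  refine ⟨x, N, fun u hu huN => ?_⟩
  have huN := hN (Ideal.pow_le_pow_right (Nat.le_succ N) huN)
  obtain ⟨a, ha, hua⟩ := exists_homogeneous_coeff (f := fun _ : Unit => φ x)
    (fun _ => hφ x) (fun _ => 1) hu (by simpa using huN)
  refine ⟨a (), ?_, ?_⟩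
  · obtain h | ⟨b, hb, hbN⟩ := ha ()
    · rw [h]; exact zero_mem _
    · obtain rfl : b = N := by omega
      exact hb
  · rw [hua]
    simp [mul_comm]

end Avoidance

/-! ### Existence of principal reductions -/

section Reduction

variable {A : Type*} [CommRing A] {I : Ideal A} {S : Type*} [CommRing S] {π : reesAlgebra I →+* S}

theorem pow_succ_eq_mul_of_le {J : Ideal A} {n m : ℕ} (h : I ^ (n + 1) = J * I ^ n) (hnm : n ≤ m) :
    I ^ (m + 1) = J * I ^ m := by
  obtain ⟨k, rfl⟩ := Nat.exists_eq_add_of_le hnm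
  rw [show n + k + 1 = n + 1 + k by ring, pow_add, h, mul_assoc, ← pow_add]

theorem reesClass_mem_pow {n : ℕ} {a : A} (ha : a ∈ I ^ n) :
    reesClass π n ha ∈ irrelevantIdeal (reesImage π) ^ n := by
  induction n generalizing a with
  | zero => simp
  | succ n ih =>
    suffices h : ∃ ha : a ∈ I ^ (n + 1),
        reesClass π (n + 1) ha ∈ irrelevantIdeal (reesImage π) ^ (n + 1) from h.2
    have ha' := ha
    rw [pow_succ] at ha'
    refine Submodule.mul_induction_on ha' (fun u hu v hv => ?_) ?_
    · have hv1 : v ∈ I ^ 1 := by simpa using hv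
      refine ⟨mul_mem_pow_add hu hv1, ?_⟩
      rw [← reesClass_mul π hu hv1, pow_succ]
      exact Ideal.mul_mem_mul (ih hu) (Ideal.subset_span ⟨1, le_rfl, reesClass_mem π hv1⟩)
    · rintro u v ⟨hu, hu'⟩ ⟨hv, hv'⟩
      refine ⟨add_mem hu hv, ?_⟩
      rw [reesClass_add π hu hv]
      exact add_mem hu' hv'

section

variable [IsLocalRing A]

theorem IsReesQuotient.eq_zero_or_isUnit (hπ : IsReesQuotient (IsLocalRing.maximalIdeal A) π)
    {u : S} (hu : u ∈ reesImage π 0) : u = 0 ∨ IsUnit u := by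
  obtain ⟨a, ha, rfl⟩ := (mem_reesImage_iff π).mp hu
  by_cases h : IsUnit a
  · right
    obtain ⟨b, hb⟩ := h.exists_right_inv
    refine IsUnit.of_mul_eq_one (reesClass π 0 (show b ∈ I ^ 0 by simp)) ?_
    rw [reesClass_mul, ← reesClass_one π (show (1 : A) ∈ I ^ 0 by simp)]
    exact reesClass_congr π _ _ rfl hb
  · left
    rw [hπ.reesClass_eq_zero_iff]
    simpa using h

end

/-- A prime of a quotient of the Rees algebra that contains `J t`, for a reduction `J` of `I`,
contains all elements of positive degree. -/
theorem irrelevantIdeal_le_of_isReduction {J : Ideal A} (hJ : IsReduction J I)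
    {p : Ideal S} (hp : p.IsPrime) (h : ∀ a (ha : a ∈ I ^ 1), a ∈ J → reesClass π 1 ha ∈ p) :
    irrelevantIdeal (reesImage π) ≤ p := by
  obtain ⟨hJI, n, hn⟩ := hJ
  have key : ∀ m a (ha : a ∈ I ^ (n + 1 + m)), reesClass π (n + 1 + m) ha ∈ p := by
    intro m a ha
    suffices h : ∃ ha : a ∈ I ^ (n + 1 + m), reesClass π (n + 1 + m) ha ∈ p from h.2
    have hpow : I ^ (n + 1 + m) = J * I ^ (n + m) := by
      rw [show n + 1 + m = n + m + 1 by ring]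
      exact pow_succ_eq_mul_of_le hn (Nat.le_add_right _ _)
    rw [hpow] at ha
    refine Submodule.mul_induction_on ha (fun u hu v hv => ?_) ?_
    · have hu1 : u ∈ I ^ 1 := by simpa using hJI hu
      have huv := mul_mem_pow_add hu1 hv
      refine ⟨by convert huv using 2; ring, ?_⟩
      rw [reesClass_congr π _ huv (by ring) rfl, ← reesClass_mul π hu1 hv, mul_comm]
      exact Ideal.mul_mem_left p _ (h u hu1 hu)
    · rintro u v ⟨hu, hu'⟩ ⟨hv, hv'⟩
      refine ⟨add_mem hu hv, ?_⟩
      rw [reesClass_add π hu hv]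
      exact add_mem hu' hv'
  rw [irrelevantIdeal, Ideal.span_le]
  rintro _ ⟨m, hm, hu⟩
  obtain ⟨a, ha, rfl⟩ := (mem_reesImage_iff π).mp hu
  -- The (n + 1)-st power of an element of positive degree has degree at least n + 1, where `key`
  -- applies.
  refine hp.mem_of_pow_mem (n + 1) ?_
  obtain ⟨l, hl⟩ := Nat.exists_eq_add_of_le (Nat.le_mul_of_pos_left (n + 1) hm)
  have ha' : a ^ (n + 1) ∈ I ^ (n + 1 + l) := by
    rw [← hl, pow_mul]; exact Ideal.pow_mem_pow ha _
  rw [reesClass_pow, reesClass_congr π _ ha' hl rfl]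
  exact key l _ ha'

variable [IsLocalRing A] [IsNoetherianRing A] [Infinite (IsLocalRing.ResidueField A)]

/-- If `dim F(I) ≤ 1` and the residue field is infinite, every reduction of `I` contains a principal
one. -/
theorem IsReesQuotient.exists_isReduction_span_singleton
    (hπ : IsReesQuotient (IsLocalRing.maximalIdeal A) π) [Ring.KrullDimLE 1 S] {J : Ideal A}
    (hJ : IsReduction J I) : ∃ x ∈ J, IsReduction (Ideal.span {x}) I := by
  let := hπ.gradedRing
  -- F(I) becomes an A-algebra, so that a ↦ a t is A-linear on J and avoidance can be applied to J
  -- itself.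
  let := (π.comp (algebraMap A (reesAlgebra I))).toAlgebra
  have := hπ.nontrivial Ideal.IsPrime.ne_top'
  have : IsNoetherianRing S := isNoetherianRing_of_surjective _ _ π hπ.surjective
  have hJ1 : ∀ a : J, (a : A) ∈ I ^ 1 := fun a => by simpa using hJ.1 a.2
  let φ : J →ₗ[A] S :=
    { toFun := fun a => reesClass π 1 (hJ1 a)
      map_add' := fun a b => reesClass_add π _ _
      map_smul' := fun c a => by
        rw [RingHom.id_apply, Algebra.smul_def]
        exact (algebraMap_mul_reesClass π c (hJ1 a)).symm }
  obtain ⟨x, N, hN⟩ := exists_eq_mul_of_mem_irrelevantIdeal_pow (𝒮 := reesImage π)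
    (fun u hu => hπ.eq_zero_or_isUnit hu) φ (fun a => reesClass_mem π (hJ1 a))
    (fun p hp h => irrelevantIdeal_le_of_isReduction hJ hp fun a _ haJ => h ⟨a, haJ⟩)
  refine ⟨x, x.2, (Ideal.span_singleton_le_iff_mem _).mpr (hJ.1 x.2), N,
    (hπ.forall_exists_eq_mul_iff Ideal.IsPrime.ne_top' (hJ1 x) N).mp fun u hu => hN u hu ?_⟩
  obtain ⟨a, ha, rfl⟩ := (mem_reesImage_iff π).mp hu
  exact reesClass_mem_pow ha

end Reduction

/-! ### Regularity in the presence of a principal reduction -/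

section PrincipalReduction

variable {A : Type*} [CommRing A] {I J : Ideal A} {x : A}

theorem reductionNumberWith_le {n : ℕ} (h : I ^ (n + 1) = J * I ^ n) :
    reductionNumberWith J I ≤ n := Nat.sInf_le h

theorem IsReduction.pow_succ_eq (hJ : IsReduction J I) {n : ℕ} (hn : reductionNumberWith J I ≤ n) :
    I ^ (n + 1) = J * I ^ n :=
  pow_succ_eq_mul_of_le (Nat.sInf_mem (s := {n : ℕ | I ^ (n + 1) = J * I ^ n}) hJ.2) hn

theorem IsReduction.mem_pow_one (hx : IsReduction (Ideal.span {x}) I) : x ∈ I ^ 1 := by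
  simpa using hx.1 (Ideal.mem_span_singleton_self x)

/-- For a principal reduction `(x)` with reduction number at most `n`, `K I ^ (n + k)` equals
`x ^ k K I ^ n`. -/
theorem IsReduction.exists_eq_pow_mul (hx : IsReduction (Ideal.span {x}) I) (K : Ideal A) {n : ℕ}
    (hn : reductionNumberWith (Ideal.span {x}) I ≤ n) (k : ℕ) {a : A} (ha : a ∈ K * I ^ (n + k)) :
    ∃ b ∈ K * I ^ n, a = x ^ k * b := by
  have hpow : I ^ (n + k) = Ideal.span {x ^ k} * I ^ n := by
    clear ha
    induction k with
    | zero => simp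
    | succ k ih =>
      rw [← add_assoc, hx.pow_succ_eq (by omega), ih, ← mul_assoc,
        Ideal.span_singleton_mul_span_singleton, pow_succ']
  rw [hpow, mul_left_comm, Ideal.mem_span_singleton_mul] at ha
  obtain ⟨b, hb, rfl⟩ := ha
  exact ⟨b, hb, rfl⟩

variable {S : Type*} [CommRing S] {π : reesAlgebra I →+* S}

theorem reesClass_pow_mul (hx : x ∈ I ^ 1) (k : ℕ) {n : ℕ} {a : A} (ha : a ∈ I ^ n) :
    reesClass π 1 hx ^ k * reesClass π n ha =
      reesClass π (n + k) (show x ^ k * a ∈ I ^ (n + k) by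
        rw [add_comm]
        exact mul_mem_pow_add (Ideal.pow_mem_pow (by simpa using hx) k) ha) := by
  rw [reesClass_pow, reesClass_mul]
  exact reesClass_congr π _ _ (by ring) rfl

variable [IsLocalRing A] [IsNoetherianRing A]

theorem IsReesQuotient.exists_eq_mul (hπ : IsReesQuotient J π) (hJ : J ≠ ⊤)
    (hx : IsReduction (Ideal.span {x}) I) :
    ∀ n ≥ reductionNumberWith (Ideal.span {x}) I, ∀ u ∈ reesImage π (n + 1),
      ∃ v ∈ reesImage π n, u = reesClass π 1 hx.mem_pow_one * v :=
  fun n hn => (hπ.forall_exists_eq_mul_iff hJ hx.mem_pow_one n).mpr (hx.pow_succ_eq hn)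

/-- The reduction number with respect to a principal reduction is a lower bound for the
regularity. -/
theorem IsReesQuotient.reductionNumberWith_le_regularity (hπ : IsReesQuotient J π) (hJ : J ≠ ⊤)
    (hx : IsReduction (Ideal.span {x}) I) {ι : Type*} [Fintype ι] {f : ι → S}
    (hf : IsGeneratingSystem (reesImage π) f) :
    ((reductionNumberWith (Ideal.span {x}) I : ℝ) : EReal) ≤ regularity f (reesImage π) := by
  let := hπ.gradedRing
  have := hπ.nontrivial hJ
  refine le_regularity_of_minimal hf (reesClass_mem π hx.mem_pow_one) (hπ.exists_eq_mul hJ hx) ?_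
  intro n hn
  by_contra! h
  rw [← hn] at h
  have := reductionNumberWith_le ((hπ.forall_exists_eq_mul_iff hJ hx.mem_pow_one n).mp h)
  omega

variable {T : Type*} [CommRing T] {ρ : reesAlgebra I →+* T}

/-- The regularity of `R(I) / K R(I)` does not exceed that of the associated graded ring if `I` has
a principal reduction. -/
theorem IsReesQuotient.regularity_le_regularity {K : Ideal A} (hπ : IsReesQuotient K π)
    (hK : K ≠ ⊤) (hρ : IsReesQuotient I ρ) (hI : I ≠ ⊤) (hx : IsReduction (Ideal.span {x}) I)
    {ι κ : Type*} [Fintype ι] [Fintype κ] {f : ι → S} (hf : IsGeneratingSystem (reesImage π) f)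
    {g : κ → T} (hg : IsGeneratingSystem (reesImage ρ) g) :
    regularity f (reesImage π) ≤ regularity g (reesImage ρ) := by
  let := hπ.gradedRing
  let := hρ.gradedRing
  have hrG := hρ.reductionNumberWith_le_regularity hI hx hg
  refine regularity_le_of_torsion hf (reesClass_mem π hx.mem_pow_one) (hπ.exists_eq_mul hK hx)
    hrG fun n k u hu hku hu0 => ?_
  obtain ⟨a, ha, rfl⟩ := (mem_reesImage_iff π).mp hu
  obtain hn | hn := le_total n (reductionNumberWith (Ideal.span {x}) I)
  · exact le_trans (EReal.coe_le_coe_iff.mpr (by exact_mod_cast hn)) hrG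
  rw [reesClass_pow_mul, hπ.reesClass_eq_zero_iff] at hku
  rw [Ne, hπ.reesClass_eq_zero_iff] at hu0
  -- Torsion in the quotient is lifted to A: x ^ k kills a - b, and b ∈ K I ^ n does not change the
  -- class of a.
  obtain ⟨b, hb, hab⟩ := hx.exists_eq_pow_mul K hn k hku
  have hle : K * I ^ n ≤ I ^ n := Ideal.mul_le_right
  have hbI : b ∈ I ^ n := hle hb
  have hc0 : a - b ≠ 0 := fun h => hu0 (by rwa [sub_eq_zero.mp h])
  -- N is the I-adic order of a - b, finite by Krull's intersection theorem; the initial form in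
  -- degree N is the torsion element of G(I).
  obtain ⟨N, hN, hcN, hcN'⟩ : ∃ N ≥ n, a - b ∈ I ^ N ∧ a - b ∉ I ^ (N + 1) := by
    by_contra! h
    have hmem : ∀ m, a - b ∈ I ^ (n + m) := by
      intro m
      induction m with
      | zero => exact sub_mem ha hbI
      | succ m ih => exact h _ (Nat.le_add_right _ _) ih
    apply hc0
    have : a - b ∈ (⨅ i : ℕ, I ^ i : Ideal A) :=
      (Submodule.mem_iInf _).mpr fun m => Ideal.pow_le_pow_right (Nat.le_add_left m n) (hmem m)
    rwa [Ideal.iInf_pow_eq_bot_of_isLocalRing I hI] at this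
  refine le_trans (EReal.coe_le_coe_iff.mpr (by exact_mod_cast hN))
    (le_regularity_of_torsion (k := k) hg (reesClass_mem ρ hx.mem_pow_one) (hρ.exists_eq_mul hI hx)
      (reesClass_mem ρ hcN) ?_ ?_)
  · rw [reesClass_pow_mul, hρ.reesClass_eq_zero_iff, mul_sub, hab, sub_self]
    exact zero_mem _
  · rwa [Ne, hρ.reesClass_eq_zero_iff, ← pow_succ']

/-- If `I` has a principal reduction generated by a regular element, then the regularity of `G(I)`
is the reduction number. -/
theorem IsReesQuotient.regularity_eq (hρ : IsReesQuotient I ρ) (hI : I ≠ ⊤)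
    (hx : IsReduction (Ideal.span {x}) I) (hreg : IsSMulRegular A x)
    {κ : Type*} [Fintype κ] {g : κ → T} (hg : IsGeneratingSystem (reesImage ρ) g) :
    regularity g (reesImage ρ) = ((reductionNumberWith (Ideal.span {x}) I : ℝ) : EReal) := by
  let := hρ.gradedRing
  refine le_antisymm (regularity_le_of_torsion hg (reesClass_mem ρ hx.mem_pow_one)
    (hρ.exists_eq_mul hI hx) le_rfl fun n k u hu hku hu0 => ?_)
    (hρ.reductionNumberWith_le_regularity hI hx hg)
  obtain ⟨a, ha, rfl⟩ := (mem_reesImage_iff ρ).mp hu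
  obtain hn | hn := le_total n (reductionNumberWith (Ideal.span {x}) I)
  · exact EReal.coe_le_coe_iff.mpr (by exact_mod_cast hn)
  rw [reesClass_pow_mul, hρ.reesClass_eq_zero_iff] at hku
  rw [Ne, hρ.reesClass_eq_zero_iff] at hu0
  obtain ⟨b, hb, hab⟩ := hx.exists_eq_pow_mul I hn k hku
  -- Cancelling x ^ k gives a = b ∈ I * I ^ n, so the class of a is zero.
  exact absurd (hreg.pow k hab ▸ hb) hu0

end PrincipalReduction

/-! ### Regular elements and minimal reductions -/

section Grade

variable {A : Type*} [CommRing A] {I : Ideal A}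

theorem exists_isSMulRegular_of_idealGrade (h : idealGrade I = 1) :
    ∃ y ∈ I, IsSMulRegular A y := by
  by_contra! hno
  have : idealGrade I ≤ 0 := by
    refine iSup₂_le fun rs hrs => ?_
    match rs with
    | [] => simp
    | y :: ys =>
      have hy := ((RingTheory.Sequence.isWeaklyRegular_cons_iff A y ys).mp hrs.1.1).1
      exact absurd hy (hno y (hrs.2 y (by simp)))
  simp [h] at this

/-- A power of y is a multiple of x, and a factor of a regular element is regular. -/
theorem IsReduction.isSMulRegular {x y : A} (hx : IsReduction (Ideal.span {x}) I) (hy : y ∈ I)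
    (hreg : IsSMulRegular A y) : IsSMulRegular A x := by
  obtain ⟨-, n, hn⟩ := hx
  have h := Ideal.pow_mem_pow hy (n + 1)
  rw [hn] at h
  obtain ⟨b, -, hb⟩ := Ideal.mem_span_singleton_mul.mp h
  have h' := hreg.pow (n + 1)
  rw [← hb, mul_comm] at h'
  exact IsSMulRegular.of_mul h'

theorem IsReduction.refl (I : Ideal A) : IsReduction I I := ⟨le_rfl, 0, by simp⟩

variable [IsLocalRing A] [IsNoetherianRing A]

/-- A principal reduction generated by a regular element is minimal. -/
theorem IsReduction.isMinimalReduction {x : A} (hx : IsReduction (Ideal.span {x}) I)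
    (hreg : IsSMulRegular A x)
    (hex : ∀ J, IsReduction J I → ∃ y ∈ J, IsReduction (Ideal.span {y}) I) :
    IsMinimalReduction (Ideal.span {x}) I := by
  refine ⟨hx, fun K hK hKx => ?_⟩
  obtain ⟨y, hyK, hy⟩ := hex K hK
  obtain ⟨u, rfl⟩ := Ideal.mem_span_singleton.mp (hKx hyK)
  by_cases hu : IsUnit u
  · rw [Ideal.span_singleton_le_iff_mem]
    obtain ⟨v, hv⟩ := hu.exists_right_inv
    have := Ideal.mul_mem_right v K hyK
    rwa [mul_assoc, hv, mul_one] at this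
  · exfalso
    obtain ⟨hle, n, hn⟩ := hy
    -- With y = x u and u ∈ 𝔪, the reduction equation gives I ^ (n + 1) ≤ 𝔪 I ^ (n + 1), so Nakayama
    -- applies; but x ^ (n + 1) ≠ 0.
    have hbot : I ^ (n + 1) = ⊥ := by
      refine Submodule.eq_bot_of_le_smul_of_le_jacobson_bot (IsLocalRing.maximalIdeal A) _
        (IsNoetherian.noetherian _) ?_ (IsLocalRing.jacobson_eq_maximalIdeal _ bot_ne_top).ge
      conv_lhs => rw [hn]
      rw [mul_comm x, ← Ideal.span_singleton_mul_span_singleton, mul_assoc, smul_eq_mul]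
      refine Ideal.mul_mono ?_ ?_
      · rw [Ideal.span_singleton_le_iff_mem]
        exact hu
      · rw [pow_succ']
        exact Ideal.mul_mono_left hx.1
    have hx0 : x ^ (n + 1) ∈ I ^ (n + 1) :=
      Ideal.pow_mem_pow (hx.1 (Ideal.mem_span_singleton_self x)) _
    rw [hbot, Ideal.mem_bot] at hx0
    exact one_ne_zero (hreg.pow (n + 1) (show x ^ (n + 1) • (1 : A) = x ^ (n + 1) • 0 by
      rw [hx0, zero_smul, zero_smul]))

end Grade

theorem isReesQuotient_mk {A : Type*} [CommRing A] (I J : Ideal A) :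
    IsReesQuotient (S := ReesQuotient I J) J
      (Ideal.Quotient.mk (J.map (algebraMap A (reesAlgebra I)))) :=
  ⟨Ideal.Quotient.mk_surjective, fun _ => Ideal.Quotient.eq_zero_iff_mem⟩

end BlowupAlgebra

end

/-! ### The theorem for F(I) and G(I) -/

theorem mainTheorem3 {A : Type*} [CommRing A] [IsLocalRing A] [IsNoetherianRing A]
    [Infinite (IsLocalRing.ResidueField A)] (I : Ideal A) (hI : I ≠ ⊤)
    (hl : BlowupAlgebra.analyticSpread I = 1)
    {s t : ℕ}
    (f : Fin s → BlowupAlgebra.FiberCone I)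
    (hf : BlowupAlgebra.IsGeneratingSystem (BlowupAlgebra.fiberGrading I) f)
    (g : Fin t → BlowupAlgebra.AssociatedGradedRing I)
    (hg : BlowupAlgebra.IsGeneratingSystem (BlowupAlgebra.assocGrading I) g) :
    BlowupAlgebra.regularity f (BlowupAlgebra.fiberGrading I) ≤
        BlowupAlgebra.regularity g (BlowupAlgebra.assocGrading I) ∧
      (BlowupAlgebra.idealGrade I = 1 →
        BlowupAlgebra.regularity f (BlowupAlgebra.fiberGrading I) =
            BlowupAlgebra.regularity g (BlowupAlgebra.assocGrading I) ∧
          BlowupAlgebra.regularity g (BlowupAlgebra.assocGrading I) =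
            (((BlowupAlgebra.reductionNumber I : ℕ) : ℝ) : EReal)) := by
  have hF := BlowupAlgebra.isReesQuotient_mk I (IsLocalRing.maximalIdeal A)
  have hG := BlowupAlgebra.isReesQuotient_mk I I
  have hm : IsLocalRing.maximalIdeal A ≠ ⊤ := Ideal.IsPrime.ne_top'
  have : Ring.KrullDimLE 1 (BlowupAlgebra.FiberCone I) := Ring.krullDimLE_iff.mpr (le_of_eq hl)
  have hex : ∀ J, BlowupAlgebra.IsReduction J I →
      ∃ x ∈ J, BlowupAlgebra.IsReduction (Ideal.span {x}) I :=
    fun J hJ => hF.exists_isReduction_span_singleton hJ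
  obtain ⟨x, -, hx⟩ := hex I (BlowupAlgebra.IsReduction.refl I)
  have hle : BlowupAlgebra.regularity f (BlowupAlgebra.fiberGrading I) ≤
      BlowupAlgebra.regularity g (BlowupAlgebra.assocGrading I) :=
    hF.regularity_le_regularity hm hG hI hx hf hg
  refine ⟨hle, fun hgrade => ?_⟩
  obtain ⟨y, hyI, hy⟩ := BlowupAlgebra.exists_isSMulRegular_of_idealGrade hgrade
  -- The left side does not involve z, so all principal reductions have the same reduction number.
  have hregG : ∀ z, BlowupAlgebra.IsReduction (Ideal.span {z}) I →
      BlowupAlgebra.regularity g (BlowupAlgebra.assocGrading I) =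
        ((BlowupAlgebra.reductionNumberWith (Ideal.span {z}) I : ℝ) : EReal) :=
    fun z hz => hG.regularity_eq hI hz (hz.isSMulRegular hyI hy) hg
  have hr : BlowupAlgebra.reductionNumber I =
      BlowupAlgebra.reductionNumberWith (Ideal.span {x}) I := by
    -- A minimal reduction contains a principal one and so equals it. That (x) is minimal makes the
    -- set nonempty, so its infimum is not the default value 0.
    have hset : {n : ℕ | ∃ J, BlowupAlgebra.IsMinimalReduction J I ∧
        n = BlowupAlgebra.reductionNumberWith J I} =
          {BlowupAlgebra.reductionNumberWith (Ideal.span {x}) I} := by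
      refine Set.Subset.antisymm ?_ ?_
      · rintro _ ⟨J, hJ, rfl⟩
        obtain ⟨z, hzJ, hz⟩ := hex J hJ.1
        obtain rfl : J = Ideal.span {z} :=
          le_antisymm (hJ.2 hz ((Ideal.span_singleton_le_iff_mem _).mpr hzJ))
            ((Ideal.span_singleton_le_iff_mem _).mpr hzJ)
        have := (hregG z hz).symm.trans (hregG x hx)
        rw [EReal.coe_eq_coe_iff] at this
        exact_mod_cast this
      · rintro _ rfl
        exact ⟨_, hx.isMinimalReduction (hx.isSMulRegular hyI hy) hex, rfl⟩
    rw [BlowupAlgebra.reductionNumber, hset, csInf_singleton]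
  rw [hr]
  exact ⟨le_antisymm hle ((hregG x hx).trans_le (hF.reductionNumberWith_le_regularity hm hx hf)),
    hregG x hx⟩
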